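/- Let $n$ be a positive integer, and let $a_0,\dots,a_{n-1},b_0,\dots,b_{n-1}$ be symbols. Let $\chi(A)$ be $1$ if $A$ is true and $0$ otherwise, and put $$\Delta(a_ib_k,a_{i'}b_{k'})=\chi(i\ge i')-\chi(i=k=i')+\chi(k\le k')-\chi(k=i'=k').$$ Let $\mathcal P_n$ be the set of partitions $\lambda_1+\cdots+\lambda_s$ (non-increasing finite sequences of positive integers, possibly empty), each part $\lambda_j$ having a colour $c(\lambda_j)\in\{a_ib_k: 0\le i,k\le n-1\}$, such that $\lambda_j-\lambda_{j+1}\ge\Delta(c(\lambda_j),c(\lambda_{j+1}))$ for $1\le j\le s-1$. The weight of such a partition is the sum of its parts. Let $\mathcal F_n$ be the set of $n^2$-coloured Frobenius partitions, i.e. of two-rowed arrays $$\begin{pmatrix}\lambda_1&\cdots&\lambda_s\\ \mu_1&\cdots&\mu_s\end{pmatrix},\qquad s\ge 0,$$ where $\lambda_1>\dots>\lambda_s$ are non-negative integers coloured by $a_0,\dots,a_{n-1}$ and $\mu_1>\dots>\mu_s$ are non-negative integers coloured by $b_0,\dots,b_{n-1}$, with respect to the orders $0_{a_{n-1}}<\cdots<0_{a_0}<1_{a_{n-1}}<\cdots<1_{a_0}<\cdots$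 and $0_{b_0}<\cdots<0_{b_{n-1}}<1_{b_0}<\cdots<1_{b_{n-1}}<\cdots$. The weight of the array is $s+\sum_j\lambda_j+\sum_j\mu_j$. Let $P_n(m;u_0,\dots,u_{n-1};v_0,\dots,v_{n-1})$ (resp. $F_n(m;u_0,\dots,u_{n-1};v_0,\dots,v_{n-1})$) be the number of elements of $\mathcal P_n$ (resp. $\mathcal F_n$) of weight $m$ in whose colours, for each $i\in\{0,\dots,n-1\}$, the symbol $a_i$ appears $u_i$ times and the symbol $b_i$ appears $v_i$ times. Write $(x;q^d)_\infty=\prod_{k\ge0}(1-xq^{dk})$. **Theorem.** In the ring of formal Laurent series in $q$ over the Laurent polynomials with integer coefficients in the indeterminates $a_0,a_1,a_2,\dots$ (where all the infinite series and products below converge $q$-adically), \begin{align*} &\sum_{m,u_0,\dots,u_{n-1},v_0,\dots,v_{n-1}\ge0}P_n(m;u_0,\dots,u_{n-1};v_0,\dots,v_{n-1})\,q^m a_0^{u_0-v_0}\cdots a_{n-1}^{u_{n-1}-v_{n-1}}\\ &=\sum_{m,u_0,\dots,u_{n-1},v_0,\dots,v_{n-1}\ge0}F_n(m;u_0,\dots,u_{n-1};v_0,\dots,v_{n-1})\,q^m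 a_0^{u_0-v_0}\cdots a_{n-1}^{u_{n-1}-v_{n-1}}\\ &=\frac1{(q;q)_\infty^n}\sum_{\substack{s_1,\dots,s_{n-1}\in\mathbb Z\\ s_n=0}}a_0^{-s_1}\prod_{i=1}^{n-1}a_i^{s_i-s_{i+1}}q^{s_i(s_i-s_{i+1})}\\ &=\frac1{(q;q)_\infty}\left(\prod_{i=1}^{n-1}\frac{(q^{i(i+1)};q^{i(i+1)})_\infty}{(q;q)_\infty}\right)\sum_{\substack{r_1,\dots,r_{n-1}:\ 0\le r_j\le j-1\\ r_n=0}}\ \prod_{i=1}^{n-1}\Bigg[a_i^{r_i-r_{i+1}}q^{r_i(r_i-r_{i+1})}\\ &\qquad\times\Big(-\Big(\prod_{\ell=0}^{i-1}a_ia_\ell^{-1}\Big)q^{\frac{i(i+1)}2+(i+1)r_i-ir_{i+1}};q^{i(i+1)}\Big)_\infty\Big(-\Big(\prod_{\ell=0}^{i-1}a_\ell a_i^{-1}\Big)q^{\frac{i(i+1)}2-(i+1)r_i+ir_{i+1}};q^{i(i+1)}\Big)_\infty\Bigg]. \end{align*} -/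

import Mathlib

namespace PrimcFrobenius

/-! ### Coloured partitions and coloured Frobenius partitions -/

/-- The minimal difference `Δ(a_i b_k, a_{i'} b_{k'})`. -/
def minDiff (i k i' k' : ℕ) : ℤ :=
  (if i ≥ i' then 1 else 0) - (if i = k ∧ k = i' then 1 else 0)
    + (if k ≤ k' then 1 else 0) - (if k = i' ∧ i' = k' then 1 else 0)

/-- A positive integer `size` in the colour `a_{aIdx} b_{bIdx}`. -/
structure ColouredPart where
  size : ℕ
  aIdx : ℕ
  bIdx : ℕ

/-- `λ_1 + ⋯ + λ_s` (the list of its parts, from left to right) is a generalised Primc partition: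
its parts are positive and non-increasing, coloured in `{a_i b_k : 0 ≤ i, k ≤ n - 1}`, and
`λ_j - λ_{j+1} ≥ Δ(c(λ_j), c(λ_{j+1}))` for all `j`. -/
def IsPrimcPartition (n : ℕ) (l : List ColouredPart) : Prop :=
  (∀ x ∈ l, 0 < x.size ∧ x.aIdx < n ∧ x.bIdx < n) ∧
  l.IsChain (fun x y => y.size ≤ x.size ∧
    minDiff x.aIdx x.bIdx y.aIdx y.bIdx ≤ (x.size : ℤ) - (y.size : ℤ))

/-- The generalised Primc partitions of `m` in which, for all `i < n`, the symbol `a_i` appears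
`u i` times and the symbol `b_i` appears `v i` times in the colours of the parts. -/
def primcPartitions (n m : ℕ) (u v : Fin n → ℕ) : Set (List ColouredPart) :=
  {l | IsPrimcPartition n l ∧ (l.map ColouredPart.size).sum = m ∧
    (∀ i : Fin n, l.countP (fun x => x.aIdx = (i : ℕ)) = u i) ∧
    (∀ i : Fin n, l.countP (fun x => x.bIdx = (i : ℕ)) = v i)}

/-- `P_n(m; u_0, …, u_{n-1}; v_0, …, v_{n-1})`. -/
noncomputable def primcCount (n m : ℕ) (u v : Fin n → ℕ) : ℕ := (primcPartitions n m u v).ncard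

/-- A non-negative integer `size` coloured with one symbol, `a_{idx}` in the first row and
`b_{idx}` in the second row of a Frobenius partition. -/
structure PrimaryPart where
  size : ℕ
  idx : ℕ

/-- The order `0_{a_{n-1}} < ⋯ < 0_{a_0} < 1_{a_{n-1}} < ⋯ < 1_{a_0} < ⋯`. -/
def aLT (x y : PrimaryPart) : Prop := x.size < y.size ∨ (x.size = y.size ∧ y.idx < x.idx)

/-- The order `0_{b_0} < ⋯ < 0_{b_{n-1}} < 1_{b_0} < ⋯ < 1_{b_{n-1}} < ⋯`. -/
def bLT (x y : PrimaryPart) : Prop := x.size < y.size ∨ (x.size = y.size ∧ x.idx < y.idx)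

/-- An `n²`-coloured Frobenius partition: two rows of the same length, both strictly decreasing
with respect to their order, the first coloured by `a_0, …, a_{n-1}` and the second coloured by
`b_0, …, b_{n-1}`. -/
structure IsFrobeniusPartition (n : ℕ) (π : List PrimaryPart × List PrimaryPart) : Prop where
  length_eq : π.1.length = π.2.length
  idx_lt₁ : ∀ x ∈ π.1, x.idx < n
  idx_lt₂ : ∀ x ∈ π.2, x.idx < n
  decreasing₁ : π.1.IsChain (fun x y => aLT y x)
  decreasing₂ : π.2.IsChain (fun x y => bLT y x)

/-- The `n²`-coloured Frobenius partitions of weight `m = s + ∑ λ_j + ∑ μ_j` in which, for all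
`i < n`, the symbol `a_i` appears `u i` times and the symbol `b_i` appears `v i` times. -/
def frobeniusPartitions (n m : ℕ) (u v : Fin n → ℕ) :
    Set (List PrimaryPart × List PrimaryPart) :=
  {π | IsFrobeniusPartition n π ∧
    π.1.length + (π.1.map PrimaryPart.size).sum + (π.2.map PrimaryPart.size).sum = m ∧
    (∀ i : Fin n, π.1.countP (fun x => x.idx = (i : ℕ)) = u i) ∧
    (∀ i : Fin n, π.2.countP (fun x => x.idx = (i : ℕ)) = v i)}

/-- `F_n(m; u_0, …, u_{n-1}; v_0, …, v_{n-1})`. -/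
noncomputable def frobeniusCount (n m : ℕ) (u v : Fin n → ℕ) : ℕ :=
  (frobeniusPartitions n m u v).ncard

theorem finite_lists_of_bound {α : Type*} (s : Set α) (hs : s.Finite) (N : ℕ) :
    {l : List α | l.length ≤ N ∧ ∀ x ∈ l, x ∈ s}.Finite := by
  have : Finite s := hs
  refine ((List.finite_length_le s N).image (List.map Subtype.val)).subset ?_
  rintro l ⟨h1, h2⟩
  exact ⟨l.attachWith _ h2, by simpa using h1, by simp⟩

theorem length_le_sum_map {α : Type*} (f : α → ℕ) (l : List α) (h : ∀ x ∈ l, 0 < f x) :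
    l.length ≤ (l.map f).sum := by
  induction l with
  | nil => simp
  | cons a t ih =>
    have h1 := ih (fun x hx => h x (by simp [hx]))
    have h2 := h a (by simp)
    simp only [List.length_cons, List.map_cons, List.sum_cons]
    omega

theorem le_sum_map {α : Type*} (f : α → ℕ) (l : List α) (x : α) (hx : x ∈ l) :
    f x ≤ (l.map f).sum :=
  List.le_sum_of_mem (List.mem_map_of_mem hx)

/-- The sets that `primcCount` counts are finite. -/
theorem primcPartitions_finite (n m : ℕ) (u v : Fin n → ℕ) : (primcPartitions n m u v).Finite := by
  have hs : {x : ColouredPart | x.size ≤ m ∧ x.aIdx < n ∧ x.bIdx < n}.Finite := by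
    refine (((Set.finite_Iic m).prod ((Set.finite_Iio n).prod (Set.finite_Iio n))).image
      (fun p : ℕ × ℕ × ℕ => ColouredPart.mk p.1 p.2.1 p.2.2)).subset ?_
    rintro ⟨a, b, c⟩ h
    exact ⟨(a, b, c), by simpa using h, rfl⟩
  refine (finite_lists_of_bound _ hs m).subset ?_
  rintro l ⟨⟨h, -⟩, hm, -⟩
  refine ⟨hm ▸ length_le_sum_map _ l fun x hx => (h x hx).1, fun x hx => ⟨?_, (h x hx).2⟩⟩
  exact hm ▸ le_sum_map _ l x hx

/-- The sets that `frobeniusCount` counts are finite. -/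
theorem frobeniusPartitions_finite (n m : ℕ) (u v : Fin n → ℕ) :
    (frobeniusPartitions n m u v).Finite := by
  have hs : {x : PrimaryPart | x.size ≤ m ∧ x.idx < n}.Finite := by
    refine (((Set.finite_Iic m).prod (Set.finite_Iio n)).image
      (fun p : ℕ × ℕ => PrimaryPart.mk p.1 p.2)).subset ?_
    rintro ⟨a, b⟩ h
    exact ⟨(a, b), by simpa using h, rfl⟩
  refine ((finite_lists_of_bound _ hs m).prod (finite_lists_of_bound _ hs m)).subset ?_
  rintro ⟨l, k⟩ ⟨⟨h0, h1, h2, -, -⟩, hm, -⟩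
  simp only at h0 h1 h2 hm
  refine ⟨⟨by simp only; omega, fun x hx => ⟨?_, h1 x hx⟩⟩,
    ⟨by simp only; omega, fun x hx => ⟨?_, h2 x hx⟩⟩⟩
  · have := le_sum_map PrimaryPart.size l x hx
    omega
  · have := le_sum_map PrimaryPart.size k x hx
    omega

/-! ### Formal series

The identities live in the ring of formal Laurent series in `q` whose coefficients are Laurent
polynomials over `ℤ` in the indeterminates `a_0, a_1, a_2, …`. -/

/-- Laurent polynomials over `ℤ` in the indeterminates `a_i`, `i ∈ ℕ`. -/
abbrev LaurentPoly : Type := AddMonoidAlgebra ℤ (ℕ →₀ ℤ)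

/-- Formal Laurent series in `q` over `LaurentPoly`. -/
abbrev QSeries : Type := LaurentSeries LaurentPoly

/-- `a_i ^ k`. -/
noncomputable def aPow (i : ℕ) (k : ℤ) : QSeries :=
  HahnSeries.C (AddMonoidAlgebra.single (Finsupp.single i k) 1)

/-- `q ^ k`. -/
noncomputable def qPow (k : ℤ) : QSeries := HahnSeries.single k 1

/-- The coefficients of `q ^ m` for `m < N`. -/
def truncate (N : ℤ) (f : QSeries) : Set.Iio N → LaurentPoly := fun m => f.coeff m

/-- The `q`-adic topology: two series are close if their coefficients of `q ^ m` agree for all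
`m < N`, with `N` large. -/
instance qAdicTopology : TopologicalSpace QSeries :=
  ⨅ N : ℤ, TopologicalSpace.induced (truncate N) ⊥

theorem tendsto_nhds_iff {β : Type*} {l : Filter β} {g : β → QSeries} {f : QSeries} :
    Filter.Tendsto g l (nhds f) ↔
      ∀ N : ℤ, ∀ᶠ b in l, ∀ m < N, (g b).coeff m = f.coeff m := by
  have key : ∀ N : ℤ, @nhds QSeries (TopologicalSpace.induced (truncate N) ⊥) f =
      Filter.comap (truncate N) (pure (truncate N f)) := by
    intro N
    let _ : TopologicalSpace (Set.Iio N → LaurentPoly) := ⊥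
    have : DiscreteTopology (Set.Iio N → LaurentPoly) := ⟨rfl⟩
    rw [nhds_induced, nhds_discrete]
  have : nhds f = ⨅ N : ℤ, Filter.comap (truncate N) (pure (truncate N f)) := by
    simp_rw [← key]
    exact nhds_iInf
  rw [this, Filter.tendsto_iInf]
  refine forall_congr' fun N => ?_
  rw [Filter.tendsto_comap_iff, Filter.tendsto_pure]
  refine Filter.eventually_congr (Filter.Eventually.of_forall fun b => ?_)
  simp only [Function.comp, truncate, funext_iff, Subtype.forall, Set.mem_Iio]

instance : T2Space QSeries := by
  refine t2_iff_nhds.2 fun {x y} h => ?_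
  have h1 : Filter.Tendsto id (nhds x ⊓ nhds y) (nhds x) := inf_le_left
  have h2 : Filter.Tendsto id (nhds x ⊓ nhds y) (nhds y) := inf_le_right
  ext1
  funext m
  rw [tendsto_nhds_iff] at h1 h2
  obtain ⟨z, hz1, hz2⟩ := ((h1 (m + 1)).and (h2 (m + 1))).exists
  rw [← hz1 m (by omega), ← hz2 m (by omega)]

/-- The infinite `q`-Pochhammer symbol `(x; q^d)_∞ = ∏_{k ≥ 0} (1 - x q^{dk})`. -/
noncomputable def qPochhammer (x : QSeries) (d : ℕ) : QSeries :=
  ∏' k : ℕ, (1 - x * qPow ((d : ℤ) * (k : ℤ)))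

theorem orderTop_prod_sub_one {ι : Type*} (S : Finset ι) (f : ι → QSeries) (B : ℤ) (hB : 0 ≤ B)
    (h : ∀ k ∈ S, (B : WithTop ℤ) ≤ (f k).orderTop) :
    (B : WithTop ℤ) ≤ (∏ k ∈ S, (1 - f k) - 1).orderTop := by
  classical
  induction S using Finset.induction_on with
  | empty => simp
  | insert a S ha ih =>
    rw [Finset.prod_insert ha]
    have h1 := ih fun k hk => h k (by simp [hk])
    have h2 := h a (by simp)
    set p := ∏ k ∈ S, (1 - f k) - 1 with hp
    have : (1 - f a) * ∏ k ∈ S, (1 - f k) - 1 = p - (f a + f a * p) := by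
      rw [hp]; ring
    rw [this]
    have h3 : (B : WithTop ℤ) ≤ (f a * p).orderTop := by
      refine le_trans ?_ HahnSeries.orderTop_add_le_mul
      calc (B : WithTop ℤ) ≤ ((B + B : ℤ) : WithTop ℤ) := by exact_mod_cast (by omega)
        _ = (B : WithTop ℤ) + B := by push_cast; rfl
        _ ≤ _ := add_le_add h2 h1
    refine le_trans ?_ HahnSeries.min_orderTop_le_orderTop_sub
    refine le_min h1 (le_trans (le_min h2 h3) HahnSeries.min_orderTop_le_orderTop_add)

theorem exists_le_orderTop (x : QSeries) : ∃ A : ℤ, (A : WithTop ℤ) ≤ x.orderTop := by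
  cases h : x.orderTop with
  | top => exact ⟨0, le_top⟩
  | coe a => exact ⟨a, le_rfl⟩

theorem coeff_eq_zero_of_le {x : QSeries} {A m : ℤ} (h : (A : WithTop ℤ) ≤ x.orderTop)
    (hm : m < A) : x.coeff m = 0 :=
  HahnSeries.coeff_eq_zero_of_lt_orderTop (lt_of_lt_of_le (by exact_mod_cast hm) h)

theorem le_orderTop_mul {x y : QSeries} {A B : ℤ} (hx : (A : WithTop ℤ) ≤ x.orderTop)
    (hy : (B : WithTop ℤ) ≤ y.orderTop) : ((A + B : ℤ) : WithTop ℤ) ≤ (x * y).orderTop := by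
  refine le_trans ?_ HahnSeries.orderTop_add_le_mul
  push_cast
  exact add_le_add hx hy

theorem le_orderTop_qPow (k : ℤ) : (k : WithTop ℤ) ≤ (qPow k).orderTop :=
  HahnSeries.le_orderTop_iff_forall.2 fun j hj => by
    have : j < k := by exact_mod_cast hj
    exact HahnSeries.coeff_single_of_ne (by omega)

/-- The product that defines `qPochhammer` converges `q`-adically. -/
theorem multipliable_qPochhammer (x : QSeries) {d : ℕ} (hd : 0 < d) :
    Multipliable fun k : ℕ => (1 - x * qPow ((d : ℤ) * (k : ℤ))) := by
  set f : ℕ → QSeries := fun k => x * qPow ((d : ℤ) * (k : ℤ)) with hf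
  obtain ⟨A, hA⟩ := exists_le_orderTop x
  have hlarge : ∀ B : ℤ, ∃ K : ℕ, ∀ k ≥ K, (B : WithTop ℤ) ≤ (f k).orderTop := by
    intro B
    refine ⟨(B - A).toNat, fun k hk => ?_⟩
    refine le_trans ?_ (le_orderTop_mul hA (le_orderTop_qPow _))
    have h1 : (k : ℤ) ≤ (d : ℤ) * k := by nlinarith
    have h2 : B ≤ A + (d : ℤ) * k := by omega
    exact_mod_cast h2
  obtain ⟨K0, hK0⟩ := hlarge 0
  obtain ⟨A0, hA0⟩ := exists_le_orderTop (∏ k ∈ Finset.range K0, (1 - f k))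
  have hcauchy : ∀ N : ℤ, ∃ K : ℕ, ∀ S : Finset ℕ, Finset.range K ⊆ S → ∀ m < N,
      (∏ k ∈ S, (1 - f k)).coeff m = (∏ k ∈ Finset.range K, (1 - f k)).coeff m := by
    intro N
    obtain ⟨K1, hK1⟩ := hlarge (max 0 (N - A0))
    set K := max K0 K1 with hK
    refine ⟨K, fun S hS m hm => ?_⟩
    have hle : (A0 : WithTop ℤ) ≤ (∏ k ∈ Finset.range K, (1 - f k)).orderTop := by
      have h0 := orderTop_prod_sub_one (Finset.range K \ Finset.range K0) f 0 le_rfl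
        (fun k hk => hK0 k (by simpa using (Finset.mem_sdiff.1 hk).2))
      have h1 := le_orderTop_mul hA0 h0
      rw [← Finset.prod_sdiff (Finset.range_subset_range.2 (le_max_left K0 K1)), ← hK]
      have h2 : (∏ k ∈ Finset.range K \ Finset.range K0, (1 - f k)) *
          ∏ k ∈ Finset.range K0, (1 - f k) =
          ∏ k ∈ Finset.range K0, (1 - f k) + (∏ k ∈ Finset.range K0, (1 - f k)) *
            (∏ k ∈ Finset.range K \ Finset.range K0, (1 - f k) - 1) := by ring
      rw [h2]
      refine le_trans (le_min hA0 ?_) HahnSeries.min_orderTop_le_orderTop_add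
      simpa using h1
    have h3 := orderTop_prod_sub_one (S \ Finset.range K) f (max 0 (N - A0)) (le_max_left _ _)
      (fun k hk => hK1 k (by
        have := (Finset.mem_sdiff.1 hk).2
        simp only [Finset.mem_range, not_lt] at this
        exact le_trans (le_max_right _ _) this))
    have h4 := le_orderTop_mul hle h3
    have h5 := coeff_eq_zero_of_le h4 (m := m) (by omega)
    rw [← Finset.prod_sdiff hS]
    have h6 : (∏ k ∈ S \ Finset.range K, (1 - f k)) * ∏ k ∈ Finset.range K, (1 - f k) =
        ∏ k ∈ Finset.range K, (1 - f k) + (∏ k ∈ Finset.range K, (1 - f k)) *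
          (∏ k ∈ S \ Finset.range K, (1 - f k) - 1) := by ring
    rw [h6, HahnSeries.coeff_add, h5, add_zero]
  choose K hK using hcauchy
  set g : ℤ → LaurentPoly :=
    fun m => (∏ k ∈ Finset.range (K (m + 1)), (1 - f k)).coeff m with hg
  have hcons : ∀ N : ℤ, ∀ m < N, (∏ k ∈ Finset.range (K N), (1 - f k)).coeff m = g m := by
    intro N m hm
    rw [← hK N _ (Finset.subset_union_left (s₂ := Finset.range (K (m + 1)))) m hm]
    exact hK (m + 1) _ Finset.subset_union_right m (by omega)
  obtain ⟨A1, hA1⟩ := exists_le_orderTop (∏ k ∈ Finset.range (K 0), (1 - f k))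
  have hbdd : BddBelow (Function.support g) := by
    refine ⟨min 0 A1, fun m hm => ?_⟩
    by_contra hlt
    rw [not_le, lt_min_iff] at hlt
    exact hm (by rw [← hcons 0 m hlt.1]; exact coeff_eq_zero_of_le hA1 hlt.2)
  refine ⟨HahnSeries.ofSuppBddBelow g hbdd, tendsto_nhds_iff.2 fun N => ?_⟩
  simp only [SummationFilter.unconditional_filter]
  filter_upwards [Filter.eventually_ge_atTop (Finset.range (K N))] with S hS m hm
  rw [HahnSeries.coeff_ofSuppBddBelow, ← hcons N m hm]
  exact hK N S hS m hm

/-- `(q^d; q^d)_∞` is invertible. -/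
theorem isUnit_qPochhammer {d : ℕ} (hd : 0 < d) : IsUnit (qPochhammer (qPow d) d) := by
  have h := (multipliable_qPochhammer (qPow d) hd).hasProd
  have h1 := tendsto_nhds_iff.1 h 1
  obtain ⟨S, hS⟩ := h1.exists
  have h2 := orderTop_prod_sub_one S (fun k => qPow d * qPow ((d : ℤ) * (k : ℤ))) 1 (by omega)
    (fun k _ => by
      refine le_trans ?_ (le_orderTop_mul (le_orderTop_qPow _) (le_orderTop_qPow _))
      have : (1 : ℤ) ≤ (d : ℤ) + (d : ℤ) * k := by
        have : (0 : ℤ) ≤ (d : ℤ) * k := by positivity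
        omega
      exact_mod_cast this)
  refine HahnSeries.isUnit_of_orderTop_pos (lt_of_lt_of_le (b := ((1 : ℤ) : WithTop ℤ))
    (by exact_mod_cast zero_lt_one) (HahnSeries.le_orderTop_iff_forall.2 fun m hm => ?_))
  have hm' : m < 1 := by exact_mod_cast hm
  have h3 := coeff_eq_zero_of_le h2 hm'
  rw [HahnSeries.coeff_sub, hS m hm', ← HahnSeries.coeff_sub] at h3
  exact h3

/-- The sequence `s_1, …, s_N, s_{N+1} = 0, …`, where `s_i` is the entry of index `i - 1` of `s`. -/
def toSeq {N : ℕ} (s : Fin N → ℤ) (i : ℕ) : ℤ :=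
  if h : 1 ≤ i ∧ i ≤ N then s ⟨i - 1, by omega⟩ else 0

/-! ### The terms of the series -/

/-- `c · q^m a_0^{u_0 - v_0} ⋯ a_{n-1}^{u_{n-1} - v_{n-1}}` for a number `c = c(m; u; v)`. -/
noncomputable def countTerm (n : ℕ) (c : ℕ → (Fin n → ℕ) → (Fin n → ℕ) → ℕ)
    (x : ℕ × (Fin n → ℕ) × (Fin n → ℕ)) : QSeries :=
  (c x.1 x.2.1 x.2.2 : QSeries) * qPow x.1 *
    ∏ i : Fin n, aPow i ((x.2.1 i : ℤ) - (x.2.2 i : ℤ))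

/-- `a_0^{-s_1} ∏_{i=1}^{n-1} a_i^{s_i - s_{i+1}} q^{s_i (s_i - s_{i+1})}`, with `s_n = 0`. -/
noncomputable def latticeTerm (n : ℕ) (s : Fin (n - 1) → ℤ) : QSeries :=
  aPow 0 (-toSeq s 1) * ∏ i ∈ Finset.Ico 1 n,
    (aPow i (toSeq s i - toSeq s (i + 1)) * qPow (toSeq s i * (toSeq s i - toSeq s (i + 1))))

/-- The term of the finite sum for the integers `r_1, …, r_{n-1}`, with `r_n = 0`:
the product over `1 ≤ i ≤ n - 1` of `a_i^{r_i - r_{i+1}} q^{r_i (r_i - r_{i+1})}`, of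
`(-(∏_{ℓ<i} a_i a_ℓ⁻¹) q^{i(i+1)/2 + (i+1) r_i - i r_{i+1}}; q^{i(i+1)})_∞` and of
`(-(∏_{ℓ<i} a_ℓ a_i⁻¹) q^{i(i+1)/2 - (i+1) r_i + i r_{i+1}}; q^{i(i+1)})_∞`. -/
noncomputable def residueTerm (n : ℕ) (r : Fin (n - 1) → ℤ) : QSeries :=
  ∏ i ∈ Finset.Ico 1 n,
    (aPow i (toSeq r i - toSeq r (i + 1)) * qPow (toSeq r i * (toSeq r i - toSeq r (i + 1))) *
      qPochhammer (-((∏ l ∈ Finset.range i, (aPow i 1 * aPow l (-1))) *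
        qPow ((i : ℤ) * (i + 1) / 2 + (i + 1) * toSeq r i - i * toSeq r (i + 1)))) (i * (i + 1)) *
      qPochhammer (-((∏ l ∈ Finset.range i, (aPow l 1 * aPow i (-1))) *
        qPow ((i : ℤ) * (i + 1) / 2 - (i + 1) * toSeq r i + i * toSeq r (i + 1)))) (i * (i + 1)))

end PrimcFrobenius

open PrimcFrobenius

namespace PrimcFrobenius

open Filter Topology

/-! ### The `q`-adic topology -/

/-! All generating functions are compared through the sum `∑' t, rowA n 0 t * rowB n 0 t`, where
`rowA n i t` and `rowB n k t` count single rows of length `t` with a condition on their smallest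
part. Since every part in `rowA n 0 t` is positive, it carries the factor `q^t` that a Frobenius
array of `t` columns contributes to the weight, so this sum is the Frobenius generating function.

Primc partitions. Removing the smallest part of a partition with `t + 1` parts gives a linear
recursion for the generating functions whose boundary condition is the minimal difference to a
colour `a_i b_k` (`mul_ladderSum_succ`). The recursion is solved explicitly by `hMixed`: sums over
`v` of `(q)_t / (q)_{t-v}` times a product of two rows of length `v`, with an extra `q^{t-v}` on one
side of the diagonal. The verification (`RowSystem.row_sum`, `RowSystem.sum_hMixed`) is a double
telescoping which closes up because rows with all parts positive are rows without restriction,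
shifted by one. A part of size 0 and colour `a_0 b_0` can be repeated freely and has weight 1, so
the boundary colour `a_0 b_0` counts the partitions with at most `t` parts (`ladderSum_primc_one`).
As `t` grows, `(q)_t / (q)_{t-v}` tends to 1 and the sum over `v` becomes the Frobenius sum.

From Frobenius partitions to the lattice. The row series satisfy `P(x) = ∏ (1 + A_j x) P(qx)`, hence
are products of Euler series. If `a_j` occurs `u_j` times and `b_j` occurs `v_j` times, the weight
depends on `p_j = u_j - v_j` and on a factor that Cauchy's identity sums to `1 / (q)_∞` for each
`j`. What remains is a theta series over the vectors `p` with sum 0, and `p_j = s_j - s_{j+1}` turns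
it into the lattice series.

From the lattice to products. With `s_i = r_i + i m_i`, `0 ≤ r_i < i`, and `p_i = m_i - m_{i+1}`,
completing squares makes the term a product of factors each depending on one `p_i` only
(`lattice_eq_prod_jacobiFactor`). Jacobi's triple product with base `q^{i(i+1)}` sums each factor.
It is itself obtained from two Euler series and Cauchy's identity. -/

/-- All the coefficients of `q ^ m` with `m < A` vanish. -/
def OrdGE (A : ℤ) (x : QSeries) : Prop := ∀ m < A, x.coeff m = 0

theorem ordGE_iff {A : ℤ} {x : QSeries} : OrdGE A x ↔ (A : WithTop ℤ) ≤ x.orderTop := by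
  rw [HahnSeries.le_orderTop_iff_forall]
  simp [OrdGE]

theorem OrdGE.mono {A B : ℤ} {x : QSeries} (h : OrdGE A x) (hB : B ≤ A) : OrdGE B x :=
  fun m hm => h m (lt_of_lt_of_le hm hB)

theorem ordGE_zero (A : ℤ) : OrdGE A 0 := fun _ _ => rfl

theorem OrdGE.add {A : ℤ} {x y : QSeries} (hx : OrdGE A x) (hy : OrdGE A y) : OrdGE A (x + y) :=
  fun m hm => by rw [HahnSeries.coeff_add, hx m hm, hy m hm, add_zero]

theorem OrdGE.neg {A : ℤ} {x : QSeries} (hx : OrdGE A x) : OrdGE A (-x) :=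
  fun m hm => by rw [HahnSeries.coeff_neg, hx m hm, neg_zero]

theorem OrdGE.sub {A : ℤ} {x y : QSeries} (hx : OrdGE A x) (hy : OrdGE A y) : OrdGE A (x - y) :=
  sub_eq_add_neg x y ▸ hx.add hy.neg

theorem OrdGE.mul {A B : ℤ} {x y : QSeries} (hx : OrdGE A x) (hy : OrdGE B y) :
    OrdGE (A + B) (x * y) :=
  ordGE_iff.2 (le_orderTop_mul (ordGE_iff.1 hx) (ordGE_iff.1 hy))

theorem OrdGE.sum {ι : Type*} {A : ℤ} {S : Finset ι} {f : ι → QSeries}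
    (h : ∀ i ∈ S, OrdGE A (f i)) : OrdGE A (∑ i ∈ S, f i) :=
  Finset.sum_induction f (OrdGE A) (fun _ _ => OrdGE.add) (ordGE_zero A) h

theorem ordGE_qPow (k : ℤ) : OrdGE k (qPow k) := ordGE_iff.2 (le_orderTop_qPow k)

theorem qPow_zero : qPow 0 = 1 := rfl

theorem qPow_add (k l : ℤ) : qPow (k + l) = qPow k * qPow l := by
  rw [qPow, qPow, qPow, HahnSeries.single_mul_single, one_mul]

theorem ordGE_one : OrdGE 0 (1 : QSeries) := qPow_zero ▸ ordGE_qPow 0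

theorem OrdGE.pow {A : ℤ} {x : QSeries} (hx : OrdGE A x) (u : ℕ) : OrdGE (u * A) (x ^ u) := by
  induction u with
  | zero => simpa using ordGE_one
  | succ u ih =>
    rw [pow_succ]
    exact (ih.mul hx).mono (by push_cast; ring_nf; rfl)

theorem exists_ordGE (x : QSeries) : ∃ A : ℤ, OrdGE A x :=
  (exists_le_orderTop x).imp fun _ h => ordGE_iff.2 h

theorem tendsto_iff_ordGE {β : Type*} {l : Filter β} {g : β → QSeries} {f : QSeries} :
    Tendsto g l (𝓝 f) ↔ ∀ N : ℤ, ∀ᶠ b in l, OrdGE N (g b - f) := by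
  rw [tendsto_nhds_iff]
  simp only [OrdGE, HahnSeries.coeff_sub, sub_eq_zero]

instance : IsTopologicalRing QSeries where
  continuous_add := continuous_iff_continuousAt.2 fun p => tendsto_iff_ordGE.2 fun N => by
    have h1 := tendsto_iff_ordGE.1 (continuous_fst.tendsto p) N
    have h2 := tendsto_iff_ordGE.1 (continuous_snd.tendsto p) N
    filter_upwards [h1, h2] with x hx hy
    rw [add_sub_add_comm]
    exact hx.add hy
  continuous_mul := continuous_iff_continuousAt.2 fun p => tendsto_iff_ordGE.2 fun N => by
    obtain ⟨A, hA⟩ := exists_ordGE p.1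
    obtain ⟨B, hB⟩ := exists_ordGE p.2
    -- The bounds `N - B` and `N - A` control the two mixed terms; the maxima with `0` and `N` make
    -- the product of the two deviations `O(q^N)` as well.
    have h1 := tendsto_iff_ordGE.1 (continuous_fst.tendsto p) (max 0 (N - B))
    have h2 := tendsto_iff_ordGE.1 (continuous_snd.tendsto p) (max N (N - A))
    filter_upwards [h1, h2] with x hx hy
    have : x.1 * x.2 - p.1 * p.2 =
        (x.1 - p.1) * (x.2 - p.2) + (x.1 - p.1) * p.2 + p.1 * (x.2 - p.2) := by ring
    rw [this]
    refine (OrdGE.add ?_ ?_).add ?_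
    · exact (hx.mul hy).mono (by omega)
    · exact (hx.mul hB).mono (by omega)
    · exact (hA.mul hy).mono (by omega)
  continuous_neg := continuous_iff_continuousAt.2 fun p => tendsto_iff_ordGE.2 fun N => by
    have h1 := tendsto_iff_ordGE.1 (continuous_id.tendsto p) N
    filter_upwards [h1] with x hx
    rw [← neg_sub_neg] at hx
    simpa using hx.neg

/-! ### Summability and products of families in the `q`-adic topology -/

/-- Each coefficient of the sum receives contributions from finitely many terms only. The
coefficients thus defined form a Laurent series, since all those of negative index already occur in
the single finite sum over `S 0`. -/
theorem summable_of_finite {β : Type*} {f : β → QSeries}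
    (h : ∀ N : ℤ, {b | ¬ OrdGE N (f b)}.Finite) : Summable f := by
  classical
  set S : ℤ → Finset β := fun N => (h N).toFinset with hS
  have hsum : ∀ (N : ℤ) (T : Finset β), S N ⊆ T → ∀ m < N,
      (∑ b ∈ T, f b).coeff m = (∑ b ∈ S N, f b).coeff m := by
    intro N T hT m hm
    rw [← Finset.sum_sdiff hT, HahnSeries.coeff_add, add_eq_right]
    refine OrdGE.sum (A := N) (fun b hb => ?_) m hm
    simpa [hS] using (Finset.mem_sdiff.1 hb).2
  set g : ℤ → LaurentPoly := fun m => (∑ b ∈ S (m + 1), f b).coeff m with hg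
  have hcons : ∀ N : ℤ, ∀ m < N, (∑ b ∈ S N, f b).coeff m = g m := by
    intro N m hm
    rw [← hsum N (S N ∪ S (m + 1)) Finset.subset_union_left m hm]
    exact hsum (m + 1) _ Finset.subset_union_right m (by omega)
  obtain ⟨A, hA⟩ := exists_ordGE (∑ b ∈ S 0, f b)
  have hbdd : BddBelow (Function.support g) := by
    refine ⟨min 0 A, fun m hm => ?_⟩
    by_contra hlt
    rw [not_le, lt_min_iff] at hlt
    exact hm (by rw [← hcons 0 m hlt.1]; exact hA m hlt.2)
  refine ⟨HahnSeries.ofSuppBddBelow g hbdd, tendsto_nhds_iff.2 fun N => ?_⟩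
  simp only [SummationFilter.unconditional_filter]
  filter_upwards [Filter.eventually_ge_atTop (S N)] with T hT m hm
  rw [HahnSeries.coeff_ofSuppBddBelow, ← hcons N m hm]
  exact hsum N T hT m hm

theorem finite_of_summable {β : Type*} {f : β → QSeries} (h : Summable f) (N : ℤ) :
    {b | ¬ OrdGE N (f b)}.Finite := by
  have h1 := tendsto_iff_ordGE.1 h.tendsto_cofinite_zero N
  simpa [Filter.eventually_cofinite] using h1

/-- A family whose `q`-order is bounded below by a function with finite sublevel sets is
summable. -/
theorem summable_of_ordGE {β : Type*} {f : β → QSeries} (w : β → ℤ) (hf : ∀ b, OrdGE (w b) (f b))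
    (hw : ∀ N : ℤ, {b | w b < N}.Finite) : Summable f :=
  summable_of_finite fun N => (hw N).subset fun b hb => by
    by_contra hlt
    exact hb ((hf b).mono (not_lt.1 hlt))

theorem _root_.Summable.of_ordGE {β γ : Type*} {f : β → QSeries} {g : γ → QSeries}
    (hf : Summable f) (e : γ → β) (he : Function.Injective e)
    (h : ∀ c N, OrdGE N (f (e c)) → OrdGE N (g c)) : Summable g :=
  summable_of_finite fun N => ((finite_of_summable hf N).preimage he.injOn).subset
    fun c hc hlt => hc (h c N hlt)

theorem exists_ordGE_of_summable {β : Type*} {f : β → QSeries} (hf : Summable f) :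
    ∃ A : ℤ, ∀ b, OrdGE A (f b) := by
  classical
  choose A hA using fun b => exists_ordGE (f b)
  have hfin := finite_of_summable hf 0
  obtain ⟨B, hB⟩ := (hfin.image A).bddBelow
  refine ⟨min 0 B, fun b => ?_⟩
  by_cases hb : OrdGE 0 (f b)
  · exact hb.mono (by omega)
  · exact (hA b).mono (le_trans (min_le_right _ _) (hB ⟨b, hb, rfl⟩))

/-- Summable families have common lower bounds `A` and `B` for their orders, so a product of order
below `N` forces the first factor below `N - B` and the second below `N - A`. -/
theorem summable_mul_prod {β γ : Type*} {f : β → QSeries} {g : γ → QSeries} (hf : Summable f)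
    (hg : Summable g) : Summable fun x : β × γ => f x.1 * g x.2 := by
  obtain ⟨A, hA⟩ := exists_ordGE_of_summable hf
  obtain ⟨B, hB⟩ := exists_ordGE_of_summable hg
  refine summable_of_finite fun N => ((finite_of_summable hf (N - B)).prod
    (finite_of_summable hg (N - A))).subset ?_
  rintro ⟨b, c⟩ h
  refine ⟨fun h1 => h ?_, fun h1 => h ?_⟩
  · exact (h1.mul (hB c)).mono (by simp)
  · exact ((hA b).mul h1).mono (by simp)

theorem ordGE_tsum {β : Type*} {f : β → QSeries} {N : ℤ} (h : ∀ b, OrdGE N (f b)) :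
    OrdGE N (∑' b, f b) := by
  by_cases hf : Summable f
  · have h1 := tendsto_iff_ordGE.1 hf.hasSum N
    obtain ⟨T, hT⟩ := h1.exists
    have h2 := (OrdGE.sum (S := T) fun b _ => h b).sub hT
    simpa using h2
  · rw [tsum_eq_zero_of_not_summable hf]
    exact ordGE_zero N

instance : T3Space QSeries := inferInstance

theorem hasSum_mul_prod {β γ : Type*} {f : β → QSeries} {g : γ → QSeries} {a b : QSeries}
    (hf : HasSum f a) (hg : HasSum g b) : HasSum (fun x : β × γ => f x.1 * g x.2) (a * b) := by
  have h := summable_mul_prod hf.summable hg.summable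
  exact hf.mul hg h

theorem hasSum_pi_prod {β : Type*} (n : ℕ) (f : Fin n → β → QSeries) (h : ∀ j, Summable (f j)) :
    HasSum (fun s : Fin n → β => ∏ j, f j (s j)) (∏ j, ∑' b, f j b) := by
  induction n with
  | zero =>
    have := hasSum_unique (fun s : Fin 0 → β => (∏ j, f j (s j) : QSeries))
    simpa only [Finset.univ_eq_empty, Finset.prod_empty] using this
  | succ n ih =>
    rw [Fin.prod_univ_succ]
    have h1 := ih (fun j => f j.succ) fun j => h j.succ
    have h2 := hasSum_mul_prod (h 0).hasSum h1
    refine ((Fin.consEquiv fun _ : Fin (n + 1) => β).hasSum_iff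
      (f := fun s : Fin (n + 1) → β => ∏ j, f j (s j))).1 ?_
    have h4 : (fun s : Fin (n + 1) → β => ∏ j, f j (s j)) ∘
        (Fin.consEquiv fun _ : Fin (n + 1) => β) =
          fun x => f 0 x.1 * ∏ j : Fin n, f j.succ (x.2 j) := by
      funext x
      rw [Function.comp_apply, Fin.prod_univ_succ]
      rfl
    rw [h4]
    exact h2

/-! ### `q`-factorials, and the identities of Euler, Cauchy and Jacobi -/

theorem isUnit_of_ordGE_sub_one {x : QSeries} (h : OrdGE 1 (x - 1)) : IsUnit x := by
  refine HahnSeries.isUnit_of_orderTop_pos (lt_of_lt_of_le ?_ (ordGE_iff.1 ?_ : ((1 : ℤ) : WithTop ℤ) ≤ _))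
  · exact_mod_cast zero_lt_one
  · exact h

/-- The identity `y = 1 - (x - 1) y` improves any bound on the order of `y` by one, until 0 is
reached. -/
theorem ordGE_of_mul_eq_one {x y : QSeries} (h : OrdGE 1 (x - 1)) (hxy : x * y = 1) :
    OrdGE 0 y := by
  obtain ⟨A, hA⟩ := exists_ordGE y
  have key : ∀ k : ℕ, OrdGE (min 0 (A + k)) y := by
    intro k
    induction k with
    | zero => exact hA.mono (by simp)
    | succ k ih =>
      have h1 : y = 1 - (x - 1) * y := by linear_combination hxy
      rw [h1]
      exact (ordGE_one.mono (min_le_left _ _)).sub ((h.mul ih).mono (by push_cast; omega))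
  exact (key (-A).toNat).mono (by omega)

/-- `(q^d; q^d)_N`. -/
noncomputable def qFac (d N : ℕ) : QSeries := ∏ k ∈ Finset.range N, (1 - qPow (d * (k + 1)))

/-- `1 / (q^d; q^d)_N`. -/
noncomputable def qInv (d N : ℕ) : QSeries := Ring.inverse (qFac d N)

/-- `(1 - q^{dN}) (1 - q^{d(N-1)}) ⋯ (1 - q^{d(N-v+1)})`. -/
noncomputable def qFall (d N v : ℕ) : QSeries := ∏ j ∈ Finset.range v, (1 - qPow (d * (N - j)))

theorem qFac_succ (d N : ℕ) : qFac d (N + 1) = qFac d N * (1 - qPow (d * (N + 1))) :=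
  Finset.prod_range_succ _ _

theorem qFall_zero (d N : ℕ) : qFall d N 0 = 1 := rfl

theorem qFall_succ (d N v : ℕ) : qFall d N (v + 1) = qFall d N v * (1 - qPow (d * (N - v))) :=
  Finset.prod_range_succ _ _

theorem qFall_succ_succ (d N v : ℕ) :
    qFall d (N + 1) (v + 1) = (1 - qPow (d * (N + 1))) * qFall d N v := by
  rw [qFall, Finset.prod_range_succ', mul_comm, qFall]
  simp

theorem qFall_eq_zero (d : ℕ) {N v : ℕ} (h : N < v) : qFall d N v = 0 :=
  Finset.prod_eq_zero (Finset.mem_range.2 h) (by simp [qPow_zero])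

theorem ordGE_prod_one_sub_sub_one {ι : Type*} (S : Finset ι) (f : ι → QSeries) {B : ℤ}
    (hB : 0 ≤ B) (h : ∀ k ∈ S, OrdGE B (f k)) : OrdGE B (∏ k ∈ S, (1 - f k) - 1) :=
  ordGE_iff.2 (orderTop_prod_sub_one S f B hB fun k hk => ordGE_iff.1 (h k hk))

theorem ordGE_qFac_sub_one {d : ℕ} (hd : 0 < d) (N : ℕ) : OrdGE 1 (qFac d N - 1) :=
  ordGE_prod_one_sub_sub_one _ _ zero_le_one fun k _ => (ordGE_qPow _).mono (by
    have : (1 : ℤ) ≤ d := by exact_mod_cast hd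
    nlinarith [mul_nonneg (Int.natCast_nonneg d) (Int.natCast_nonneg k)])

theorem ordGE_qFall_sub_one {d : ℕ} (hd : 0 < d) {N v : ℕ} (hv : v ≤ N) :
    OrdGE (N - v + 1) (qFall d N v - 1) :=
  ordGE_prod_one_sub_sub_one _ _ (by omega) fun j hj => (ordGE_qPow _).mono (by
    have h1 : (1 : ℤ) ≤ d := by exact_mod_cast hd
    have h2 : (j : ℤ) + 1 ≤ v := by exact_mod_cast Finset.mem_range.1 hj
    have h3 : (v : ℤ) ≤ N := by exact_mod_cast hv
    nlinarith)

theorem qFac_mul_qInv {d : ℕ} (hd : 0 < d) (N : ℕ) : qFac d N * qInv d N = 1 :=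
  Ring.mul_inverse_cancel _ (isUnit_of_ordGE_sub_one (ordGE_qFac_sub_one hd N))

theorem ordGE_qInv {d : ℕ} (hd : 0 < d) (N : ℕ) : OrdGE 0 (qInv d N) :=
  ordGE_of_mul_eq_one (ordGE_qFac_sub_one hd N) (qFac_mul_qInv hd N)

theorem qFac_zero (d : ℕ) : qFac d 0 = 1 := rfl

theorem qInv_zero {d : ℕ} (hd : 0 < d) : qInv d 0 = 1 := by
  simpa [qFac_zero] using qFac_mul_qInv hd 0

theorem one_sub_mul_qInv_succ {d : ℕ} (hd : 0 < d) (N : ℕ) :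
    (1 - qPow (d * (N + 1))) * qInv d (N + 1) = qInv d N := by
  have h1 := qFac_mul_qInv hd N
  have h2 := qFac_mul_qInv hd (N + 1)
  rw [qFac_succ] at h2
  linear_combination (-(1 - qPow (d * (N + 1))) * qInv d (N + 1)) * h1 + qInv d N * h2

/-! #### Euler's identity -/

/-- `Q^{u(u-1)/2} / (Q; Q)_u` for `Q = q^d`. -/
noncomputable def eulerCoeff (d u : ℕ) : QSeries := qPow (d * (u.choose 2 : ℕ)) * qInv d u

theorem eulerCoeff_zero {d : ℕ} (hd : 0 < d) : eulerCoeff d 0 = 1 := by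
  simp [eulerCoeff, qInv_zero hd, qPow_zero]

theorem choose_succ_two (u : ℕ) : (u + 1).choose 2 = u.choose 2 + u := by
  rw [Nat.choose_succ_succ' u 1, Nat.choose_one_right, add_comm]

theorem two_mul_choose_two (u : ℕ) : 2 * (u.choose 2 : ℤ) = u * (u - 1) := by
  induction u with
  | zero => simp
  | succ u ih => rw [choose_succ_two]; push_cast; linear_combination ih

/-- This is the functional equation `F(x) = (1 + x) F(Qx)` of the Euler series, read on
coefficients. -/
theorem eulerCoeff_succ {d : ℕ} (hd : 0 < d) (u : ℕ) :
    eulerCoeff d (u + 1) =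
      qPow (d * (u + 1)) * eulerCoeff d (u + 1) + qPow (d * u) * eulerCoeff d u := by
  rw [eulerCoeff, eulerCoeff, ← one_sub_mul_qInv_succ hd u, choose_succ_two]
  push_cast
  rw [mul_add, qPow_add]
  ring

theorem ordGE_eulerCoeff {d : ℕ} (hd : 0 < d) (u : ℕ) : OrdGE (u.choose 2 : ℕ) (eulerCoeff d u) :=
  ((ordGE_qPow _).mul (ordGE_qInv hd u)).mono (by
    have h1 : (1 : ℤ) ≤ d := by exact_mod_cast hd
    nlinarith [Int.natCast_nonneg (u.choose 2)])

theorem qPow_mul (k : ℤ) (u : ℕ) : qPow (k * u) = qPow k ^ u := by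
  induction u with
  | zero => simp [qPow_zero]
  | succ u ih => rw [pow_succ, ← ih, ← qPow_add]; push_cast; ring_nf

theorem finite_quadratic_lt (A N : ℤ) : {u : ℕ | u * A + (u.choose 2 : ℕ) < N}.Finite := by
  -- Beyond this bound `2A + (u - 1) ≥ 2|N|`, and twice the expression is `u (2A + u - 1)`.
  refine (Set.finite_Iic (2 * (|A| + |N|) + 2).toNat).subset fun u hu => ?_
  simp only [Set.mem_ofPred_eq, Set.mem_Iic] at hu ⊢
  have h1 := two_mul_choose_two u
  by_contra hlt
  have h2 : 2 * (|A| + |N|) + 2 < (u : ℤ) := by omega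
  have h3 := neg_abs_le A
  have h4 := le_abs_self N
  have h5 := abs_nonneg A
  have h6 := abs_nonneg N
  have h7 : (u : ℤ) * (2 * |N|) ≤ u * (2 * A + (u - 1)) :=
    mul_le_mul_of_nonneg_left (by linarith) (by positivity)
  nlinarith

theorem summable_euler {d : ℕ} (hd : 0 < d) (x : QSeries) :
    Summable fun u : ℕ => x ^ u * eulerCoeff d u := by
  obtain ⟨A, hA⟩ := exists_ordGE x
  exact summable_of_ordGE (fun u => u * A + (u.choose 2 : ℕ))
    (fun u => (hA.pow u).mul (ordGE_eulerCoeff hd u)) (finite_quadratic_lt A)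

theorem tsum_euler_functional {d : ℕ} (hd : 0 < d) (x : QSeries) :
    ∑' u : ℕ, x ^ u * eulerCoeff d u =
      (1 + x) * ∑' u : ℕ, (x * qPow d) ^ u * eulerCoeff d u := by
  have h1 := summable_euler hd x
  have h2 := summable_euler hd (x * qPow d)
  have h3 : Summable fun u : ℕ => (x * qPow d) ^ (u + 1) * eulerCoeff d (u + 1) :=
    (summable_nat_add_iff 1).2 h2
  have h4 := h2.mul_left x
  rw [h1.tsum_eq_zero_add, add_mul, one_mul, ← h2.tsum_mul_left]
  conv_rhs => rw [h2.tsum_eq_zero_add]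
  rw [add_assoc, ← h3.tsum_add h4]
  simp only [pow_zero]
  congr 1
  refine tsum_congr fun u => ?_
  rw [mul_pow, mul_pow, ← qPow_mul, ← qPow_mul]
  push_cast
  linear_combination x ^ (u + 1) * eulerCoeff_succ hd u

theorem tendsto_tsum_euler {d : ℕ} (hd : 0 < d) (x : QSeries) :
    Tendsto (fun K : ℕ => ∑' u : ℕ, (x * qPow (d * K)) ^ u * eulerCoeff d u) atTop (𝓝 1) := by
  obtain ⟨A, hA⟩ := exists_ordGE x
  refine tendsto_iff_ordGE.2 fun N => ?_
  filter_upwards [eventually_ge_atTop (max 0 (N - A) - min 0 A).toNat] with K hK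
  rw [(summable_euler hd _).tsum_eq_zero_add, eulerCoeff_zero hd, pow_zero, mul_one, add_sub_cancel_left]
  refine ordGE_tsum fun u => ?_
  have h1 : (1 : ℤ) ≤ d := by exact_mod_cast hd
  have h2 : (K : ℤ) ≤ d * K := by nlinarith [Int.natCast_nonneg K]
  have h3 : max N 0 ≤ A + d * K := by omega
  refine (((hA.mul (ordGE_qPow (d * K))).pow (u + 1)).mul (ordGE_eulerCoeff hd _)).mono ?_
  push_cast
  have h4 : 0 ≤ (u : ℤ) * (A + d * K) := mul_nonneg (by positivity) (by omega)
  have h5 : (0 : ℤ) ≤ ((u + 1).choose 2 : ℕ) := by positivity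
  have h6 : N ≤ A + d * K := by omega
  linarith

/-- Euler: `(-x; Q)_∞ = ∑ x^u Q^{u(u-1)/2} / (Q; Q)_u` for `Q = q^d`. -/
theorem hasSum_euler {d : ℕ} (hd : 0 < d) (x : QSeries) :
    HasSum (fun u : ℕ => x ^ u * eulerCoeff d u) (qPochhammer (-x) d) := by
  -- The functional equation is iterated `K` times; the remaining factor `F(x Q^K)` tends to 1.
  have key : ∀ K : ℕ, ∑' u : ℕ, x ^ u * eulerCoeff d u =
      (∏ k ∈ Finset.range K, (1 - -x * qPow (d * k))) *
        ∑' u : ℕ, (x * qPow (d * K)) ^ u * eulerCoeff d u := by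
    intro K
    induction K with
    | zero => simp [qPow_zero]
    | succ K ih =>
      rw [ih, tsum_euler_functional hd (x * qPow (d * K)), Finset.prod_range_succ, mul_assoc x,
        ← qPow_add]
      push_cast
      rw [mul_add_one (d : ℤ) (K : ℤ)]
      ring
  have h1 := (multipliable_qPochhammer (-x) hd).hasProd.tendsto_prod_nat
  have h2 := h1.mul (tendsto_tsum_euler hd x)
  rw [mul_one] at h2
  have h3 := tendsto_nhds_unique (h2.congr fun K => (key K).symm) tendsto_const_nhds
  rw [qPochhammer, h3]
  exact (summable_euler hd x).hasSum

/-! #### Cauchy's identity -/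

/-- The error is uniformly small: `qFall d N v - 1` is `O(q^{N-v+1})` and `g v` is `O(q^v)`, so each
term of the difference is `O(q^{N+1})`. This passage to the limit serves both Cauchy's identity and
the Primc partitions with at most `N` parts. -/
theorem tendsto_sum_qFall_mul {d : ℕ} (hd : 0 < d) {g : ℕ → QSeries} (hg : ∀ v : ℕ, OrdGE v (g v)) :
    Tendsto (fun N => ∑ v ∈ Finset.range (N + 1), qFall d N v * g v) atTop (𝓝 (∑' v, g v)) := by
  have hs : Summable g := summable_of_ordGE _ hg fun N =>
    (Set.finite_Iic N.toNat).subset fun v hv => by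
      simp only [Set.mem_ofPred_eq, Set.mem_Iic] at hv ⊢
      omega
  have h1 := (tendsto_add_atTop_iff_nat 1).2 hs.hasSum.tendsto_sum_nat
  have h2 : Tendsto (fun N => ∑ v ∈ Finset.range (N + 1), (qFall d N v - 1) * g v) atTop (𝓝 0) := by
    refine tendsto_iff_ordGE.2 fun M => ?_
    filter_upwards [eventually_ge_atTop M.toNat] with N hN
    rw [sub_zero]
    refine OrdGE.sum fun v hv => ?_
    exact ((ordGE_qFall_sub_one hd (Nat.lt_succ_iff.1 (Finset.mem_range.1 hv))).mul (hg v)).mono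
      (by omega)
  have h3 := h2.add h1
  rw [zero_add] at h3
  refine h3.congr fun N => ?_
  rw [← Finset.sum_add_distrib]
  exact Finset.sum_congr rfl fun v _ => by ring

/-- A finite form of Cauchy's identity. Writing `S(N, e)` for the left side, a `q`-Pascal rule for
`qFall` gives `S(N+1, e) = S(N, e) + Q^{N+1+e} S(N, e+1)` with `Q = q^d`, and `1 / (Q)_{N+e}`
satisfies the same recursion. The induction needs all `e` at once. -/
theorem sum_qFall_eq_qInv {d : ℕ} (hd : 0 < d) (N e : ℕ) :
    ∑ v ∈ Finset.range (N + 1),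
      qFall d N v * (qPow (d * (v * (v + e))) * qInv d v * qInv d (v + e)) = qInv d (N + e) := by
  induction N generalizing e with
  | zero => simp [qFall_zero, qPow_zero, qInv_zero hd]
  | succ N ih =>
    have key : ∀ v : ℕ, qFall d (N + 1) (v + 1) * (qPow (d * ((v + 1 : ℕ) * ((v + 1 : ℕ) + e))) *
        qInv d (v + 1) * qInv d (v + 1 + e)) =
        qFall d N (v + 1) * (qPow (d * ((v + 1 : ℕ) * ((v + 1 : ℕ) + e))) *
          qInv d (v + 1) * qInv d (v + 1 + e)) +
        qPow (d * (N + 1 + e)) * (qFall d N v * (qPow (d * (v * (v + (e + 1 : ℕ)))) *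
          qInv d v * qInv d (v + (e + 1)))) := by
      intro v
      have h1 : qPow (d * (N + 1 + e)) * qPow (d * (v * (v + (e + 1 : ℕ)))) =
          qPow (d * (N - v)) * qPow (d * ((v + 1 : ℕ) * ((v + 1 : ℕ) + e))) := by
        rw [← qPow_add, ← qPow_add]
        congr 1
        push_cast
        ring
      have h2 : qPow (d * (N + 1 : ℤ)) = qPow (d * (N - v)) * qPow (d * (v + 1)) := by
        rw [← qPow_add]
        congr 1
        ring
      rw [qFall_succ_succ, qFall_succ, show v + (e + 1) = v + 1 + e by ring, h2,
        ← one_sub_mul_qInv_succ hd v]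
      linear_combination (-qFall d N v * (1 - qPow (d * (v + 1))) * qInv d (v + 1) *
        qInv d (v + 1 + e)) * h1
    rw [Finset.sum_range_succ', Finset.sum_congr rfl fun v _ => key v, Finset.sum_add_distrib,
      ← Finset.mul_sum, ih, show N + (e + 1) = N + 1 + e by ring, add_right_comm,
      qFall_zero, ← qFall_zero d N, ← Finset.sum_range_succ' (fun v => qFall d N v *
        (qPow (d * ((v : ℕ) * ((v : ℕ) + e))) * qInv d v * qInv d (v + e))) (N + 1),
      Finset.sum_range_succ, ih, qFall_eq_zero d (Nat.lt_succ_self N),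
      ← one_sub_mul_qInv_succ hd (N + e), show N + 1 + e = N + e + 1 by ring]
    push_cast
    ring_nf

/-- `1 / (q^d; q^d)_∞`. -/
noncomputable def qInvInf (d : ℕ) : QSeries := Ring.inverse (qPochhammer (qPow d) d)

theorem qPochhammer_mul_qInvInf {d : ℕ} (hd : 0 < d) : qPochhammer (qPow d) d * qInvInf d = 1 :=
  Ring.mul_inverse_cancel _ (isUnit_qPochhammer hd)

theorem tendsto_qFac {d : ℕ} (hd : 0 < d) :
    Tendsto (qFac d) atTop (𝓝 (qPochhammer (qPow d) d)) := by
  refine (multipliable_qPochhammer (qPow d) hd).hasProd.tendsto_prod_nat.congr fun N => ?_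
  refine Finset.prod_congr rfl fun k _ => ?_
  rw [← qPow_add, mul_add_one, add_comm]

/-- Cauchy: `∑ Q^{v(v+e)} / ((Q; Q)_v (Q; Q)_{v+e}) = 1 / (Q; Q)_∞` for `Q = q^d`. -/
theorem hasSum_cauchy {d : ℕ} (hd : 0 < d) (e : ℕ) :
    HasSum (fun v : ℕ => qPow (d * (v * (v + e))) * qInv d v * qInv d (v + e)) (qInvInf d) := by
  set g : ℕ → QSeries := fun v => qPow (d * (v * (v + e))) * qInv d v * qInv d (v + e) with hg
  have h1 : (1 : ℤ) ≤ d := by exact_mod_cast hd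
  have hord : ∀ v : ℕ, OrdGE v (g v) := fun v =>
    (((ordGE_qPow _).mul (ordGE_qInv hd v)).mul (ordGE_qInv hd (v + e))).mono (by
      have h2 : (v : ℤ) ≤ v * (v + e) := by
        have : v ≤ v * (v + e) := by
          rcases Nat.eq_zero_or_pos v with rfl | hv
          · simp
          · exact Nat.le_mul_of_pos_right v (by omega)
        exact_mod_cast this
      nlinarith [mul_nonneg (sub_nonneg.2 h1) (by positivity : (0 : ℤ) ≤ v * (v + e))])
  have hs : Summable g := summable_of_ordGE _ hord fun N =>
    (Set.finite_Iic N.toNat).subset fun v hv => by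
      simp only [Set.mem_ofPred_eq, Set.mem_Iic] at hv ⊢
      omega
  have h2 := (tendsto_sum_qFall_mul hd hord).mul ((tendsto_add_atTop_iff_nat e).2 (tendsto_qFac hd))
  -- The finite identity multiplied by `(Q)_{N+e}` is constantly 1; both factors converge.
  have h3 : (∑' v, g v) * qPochhammer (qPow d) d = 1 := by
    refine tendsto_nhds_unique (h2.congr fun N => ?_) tendsto_const_nhds
    rw [hg, sum_qFall_eq_qInv hd N e, mul_comm]
    exact qFac_mul_qInv hd (N + e)
  have h4 : qInvInf d = ∑' v, g v := by
    linear_combination (-qInvInf d) * h3 + (∑' v, g v) * qPochhammer_mul_qInvInf hd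
  rw [h4]
  exact hs.hasSum

/-- Pairs `(u, v)` of natural numbers, described by `u - v` and `min u v`. -/
def subMinEquiv : ℤ × ℕ ≃ ℕ × ℕ where
  toFun x := (x.2 + x.1.toNat, x.2 + (-x.1).toNat)
  invFun y := ((y.1 : ℤ) - y.2, min y.1 y.2)
  left_inv x := by
    ext
    · simp only
      omega
    · simp only
      omega
  right_inv y := by
    ext
    · simp only
      omega
    · simp only
      omega

theorem _root_.HasSum.of_eq {β : Type*} {f g : β → QSeries} {a b : QSeries} (h : HasSum f a)
    (hfg : ∀ x, g x = f x) (hab : b = a) : HasSum g b := by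
  rw [hab, funext hfg]
  exact h

/-- Cauchy's identity with `e = |p|`: for fixed difference `p` the pair is `(v + e, v)` or `(v, v +
e)`, and the summand is symmetric. -/
theorem hasSum_fibre {d : ℕ} (hd : 0 < d) (p : ℤ) :
    HasSum (fun k : ℕ => qPow (d * ((subMinEquiv (p, k)).1 * (subMinEquiv (p, k)).2)) *
      qInv d (subMinEquiv (p, k)).1 * qInv d (subMinEquiv (p, k)).2) (qInvInf d) := by
  obtain ⟨e, rfl | rfl⟩ := Int.eq_nat_or_neg p
  · convert hasSum_cauchy hd e using 2 with k
    simp only [subMinEquiv, Equiv.coe_fn_mk, Int.toNat_natCast, Int.toNat_neg_natCast, add_zero]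
    push_cast
    ring_nf
  · convert hasSum_cauchy hd e using 2 with k
    simp only [subMinEquiv, Equiv.coe_fn_mk, Int.toNat_natCast, Int.toNat_neg_natCast, add_zero,
      neg_neg]
    push_cast
    ring_nf

/-- Summing over all pairs `(u, v)` of natural numbers by the value of `u - v`. -/
theorem hasSum_of_hasSum_pairs {d : ℕ} (hd : 0 < d) {W : ℤ → QSeries} {a : QSeries}
    (h : HasSum (fun x : ℕ × ℕ => W ((x.1 : ℤ) - x.2) *
      (qPow (d * (x.1 * x.2)) * qInv d x.1 * qInv d x.2)) a) :
    HasSum W (a * qPochhammer (qPow d) d) := by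
  have h1 := (subMinEquiv.hasSum_iff).2 h
  have h2 : HasSum (fun p => W p * qInvInf d) a := h1.prod_fiberwise fun p => by
    refine ((hasSum_fibre hd p).mul_left (W p)).of_eq (fun k => ?_) rfl
    rw [Function.comp_apply]
    congr 2
    exact congrArg Prod.fst (subMinEquiv.left_inv (p, k))
  refine (h2.mul_right (qPochhammer (qPow d) d)).of_eq (fun p => ?_) rfl
  rw [mul_assoc, mul_comm (qInvInf d), qPochhammer_mul_qInvInf hd, mul_one]

/-- Jacobi's triple product identity for `Q = q^{2e}`, where `Y p` stands for the `p`-th power of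
an invertible element. -/
theorem hasSum_jacobi {e : ℕ} (he : 0 < e) {Y : ℤ → QSeries} (hY0 : Y 0 = 1)
    (hY : ∀ p p', Y (p + p') = Y p * Y p') :
    HasSum (fun p : ℤ => Y p * qPow (e * (p * p)))
      (qPochhammer (-(Y 1 * qPow e)) (2 * e) * qPochhammer (-(Y (-1) * qPow e)) (2 * e) *
        qPochhammer (qPow (2 * e : ℕ)) (2 * e)) := by
  have hd : 0 < 2 * e := by omega
  have hpow : ∀ (c : ℤ) (u : ℕ), Y c ^ u = Y (u * c) := by
    intro c u
    induction u with
    | zero => simp [hY0]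
    | succ u ih => rw [pow_succ, ih, ← hY]; push_cast; ring_nf
  refine hasSum_of_hasSum_pairs hd ?_
  refine (hasSum_mul_prod (hasSum_euler hd (Y 1 * qPow e))
    (hasSum_euler hd (Y (-1) * qPow e))).of_eq (fun x => ?_) rfl
  obtain ⟨u, v⟩ := x
  simp only [mul_pow, eulerCoeff, hpow, ← qPow_mul]
  -- Both exponents equal `e (u² + v²)`, by `u² = u + 2 * u.choose 2`.
  have h1 : qPow (e * (((u : ℤ) - v) * (u - v))) * qPow ((2 * e : ℕ) * (u * v)) =
      qPow (e * u) * qPow (e * v) * qPow ((2 * e : ℕ) * (u.choose 2 : ℕ)) *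
        qPow ((2 * e : ℕ) * (v.choose 2 : ℕ)) := by
    simp only [← qPow_add]
    congr 1
    push_cast
    linear_combination -(e : ℤ) * two_mul_choose_two u - (e : ℤ) * two_mul_choose_two v
  have h2 : Y ((u : ℤ) - v) = Y (u * 1) * Y (v * -1) := by
    rw [← hY]
    ring_nf
  rw [h2]
  linear_combination (Y (u * 1) * Y (v * -1) * qInv (2 * e) u * qInv (2 * e) v) * h1

/-! ### The series over the lattice as a finite sum of products -/

theorem aPow_zero (i : ℕ) : aPow i 0 = 1 := by
  rw [aPow, Finsupp.single_zero]
  rfl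

theorem aPow_add (i : ℕ) (k l : ℤ) : aPow i (k + l) = aPow i k * aPow i l := by
  rw [aPow, aPow, aPow, ← map_mul, AddMonoidAlgebra.single_mul_single, Finsupp.single_add, one_mul]

theorem ordGE_C (x : LaurentPoly) : OrdGE 0 (HahnSeries.C x : QSeries) := fun m hm => by
  rw [HahnSeries.C_apply, HahnSeries.coeff_single_of_ne (by omega)]

theorem ordGE_aPow (i : ℕ) (k : ℤ) : OrdGE 0 (aPow i k) := ordGE_C _

/-- The `p`-th power of `(∏_{ℓ < i} a_i a_ℓ⁻¹) q^c`. -/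
noncomputable def ratioPow (i : ℕ) (c p : ℤ) : QSeries :=
  (∏ l ∈ Finset.range i, (aPow i p * aPow l (-p))) * qPow (c * p)

theorem ratioPow_zero (i : ℕ) (c : ℤ) : ratioPow i c 0 = 1 := by
  simp [ratioPow, aPow_zero, qPow_zero]

theorem ratioPow_add (i : ℕ) (c p p' : ℤ) :
    ratioPow i c (p + p') = ratioPow i c p * ratioPow i c p' := by
  have h : ∏ l ∈ Finset.range i, (aPow i (p + p') * aPow l (-(p + p'))) =
      (∏ l ∈ Finset.range i, (aPow i p * aPow l (-p))) *
        ∏ l ∈ Finset.range i, (aPow i p' * aPow l (-p')) := by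
    rw [← Finset.prod_mul_distrib]
    refine Finset.prod_congr rfl fun l _ => ?_
    rw [aPow_add, neg_add, aPow_add]
    ring
  rw [ratioPow, ratioPow, ratioPow, h, mul_add, qPow_add]
  ring

theorem prod_aPow_const (i k : ℕ) (p : ℤ) : ∏ _l ∈ Finset.range k, aPow i p = aPow i (k * p) := by
  rw [Finset.prod_const, Finset.card_range]
  induction k with
  | zero => simp [aPow_zero]
  | succ k ih => rw [pow_succ, ih, ← aPow_add]; push_cast; ring_nf

/-- The `i`-th factor of the term of the series over the lattice. -/
noncomputable def latticeFactor (s : ℕ → ℤ) (i : ℕ) : QSeries :=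
  aPow i (s i - s (i + 1)) * qPow (s i * (s i - s (i + 1)))

/-- Here `s_i = r_i + i m_i`. Completing the square in `m_i - m_{i+1}` leaves a correction in `m_i`
on one side and one in `m_{i+1}` on the other. Since `e` is the `i`-th triangular number, they are
the values of one expression at `i` and `i + 1`, so they telescope in the product over `i`. -/
theorem latticeFactor_mul (r m : ℕ → ℤ) (i e : ℕ) (he : 2 * e = i * (i + 1)) :
    latticeFactor (fun i => r i + i * m i) i *
        ((∏ l ∈ Finset.range (i + 1), aPow l (m (i + 1))) *
          qPow (e * (m (i + 1) * m (i + 1)) + i * (r (i + 1) * m (i + 1)))) =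
      latticeFactor r i * (ratioPow i ((i + 1) * r i - i * r (i + 1)) (m i - m (i + 1)) *
        qPow (e * ((m i - m (i + 1)) * (m i - m (i + 1))))) *
        ((∏ l ∈ Finset.range i, aPow l (m i)) *
          qPow ((e - i) * (m i * m i) + (i - 1) * (r i * m i))) := by
  have he' : (2 : ℤ) * e = i * (i + 1) := by exact_mod_cast he
  have hprod : (∏ l ∈ Finset.range i, aPow l (-(m i - m (i + 1)))) *
      ∏ l ∈ Finset.range i, aPow l (m i) = ∏ l ∈ Finset.range i, aPow l (m (i + 1)) := by
    rw [← Finset.prod_mul_distrib]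
    refine Finset.prod_congr rfl fun l _ => ?_
    rw [← aPow_add]
    ring_nf
  have ha : aPow i (r i + i * m i - (r (i + 1) + (i + 1 : ℕ) * m (i + 1))) * aPow i (m (i + 1)) =
      aPow i (r i - r (i + 1)) * aPow i (i * (m i - m (i + 1))) := by
    rw [← aPow_add, ← aPow_add]
    congr 1
    push_cast
    ring
  have hq : qPow ((r i + i * m i) * (r i + i * m i - (r (i + 1) + (i + 1 : ℕ) * m (i + 1)))) *
      qPow (e * (m (i + 1) * m (i + 1)) + i * (r (i + 1) * m (i + 1))) =
      qPow (r i * (r i - r (i + 1))) *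
        qPow (((i + 1) * r i - i * r (i + 1)) * (m i - m (i + 1))) *
        qPow (e * ((m i - m (i + 1)) * (m i - m (i + 1)))) *
        qPow ((e - i) * (m i * m i) + (i - 1) * (r i * m i)) := by
    simp only [← qPow_add]
    congr 1
    push_cast
    linear_combination (m i * m (i + 1) - m i * m i) * he'
  rw [latticeFactor, latticeFactor, ratioPow, Finset.prod_mul_distrib, prod_aPow_const,
    Finset.prod_range_succ, ← hprod]
  linear_combination ((∏ l ∈ Finset.range i, aPow l (-(m i - m (i + 1)))) *
      ∏ l ∈ Finset.range i, aPow l (m i)) * (aPow i (m (i + 1)) *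
        aPow i (r i + i * m i - (r (i + 1) + (i + 1 : ℕ) * m (i + 1))) * hq +
      qPow (r i * (r i - r (i + 1))) *
        qPow (((i + 1) * r i - i * r (i + 1)) * (m i - m (i + 1))) *
        qPow (e * ((m i - m (i + 1)) * (m i - m (i + 1)))) *
        qPow ((e - i) * (m i * m i) + (i - 1) * (r i * m i)) * ha)

/-- `i (i + 1) / 2`. -/
def triangle (i : ℕ) : ℕ := i * (i + 1) / 2

theorem two_mul_triangle (i : ℕ) : 2 * triangle i = i * (i + 1) :=
  Nat.mul_div_cancel' (Nat.even_mul_succ_self i).two_dvd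

theorem triangle_succ (i : ℕ) : triangle (i + 1) = triangle i + (i + 1) := by
  have h1 := two_mul_triangle i
  have h2 := two_mul_triangle (i + 1)
  nlinarith

/-- The correction by which the two factorisations of the term of the series differ. -/
noncomputable def boundaryFactor (r m : ℕ → ℤ) (i : ℕ) : QSeries :=
  (∏ l ∈ Finset.range i, aPow l (m i)) *
    qPow ((triangle i - i) * (m i * m i) + (i - 1) * (r i * m i))

/-- The summand of Jacobi's triple product at `p = m_i - m_{i+1}`. -/
noncomputable def jacobiFactor (r : ℕ → ℤ) (i : ℕ) (p : ℤ) : QSeries :=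
  ratioPow i ((i + 1) * r i - i * r (i + 1)) p * qPow (triangle i * (p * p))

theorem prod_latticeFactor (r m : ℕ → ℤ) (N : ℕ) :
    (∏ i ∈ Finset.Ico 1 (N + 1), latticeFactor (fun i => r i + i * m i) i) *
        boundaryFactor r m (N + 1) =
      (∏ i ∈ Finset.Ico 1 (N + 1), (latticeFactor r i * jacobiFactor r i (m i - m (i + 1)))) *
        boundaryFactor r m 1 := by
  induction N with
  | zero => simp
  | succ N ih =>
    have h := latticeFactor_mul r m (N + 1) (triangle (N + 1)) (two_mul_triangle _)
    have h2 : boundaryFactor r m (N + 1 + 1) =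
        ((∏ l ∈ Finset.range (N + 1 + 1), aPow l (m (N + 1 + 1))) *
          qPow (triangle (N + 1) * (m (N + 1 + 1) * m (N + 1 + 1)) +
            (N + 1 : ℕ) * (r (N + 1 + 1) * m (N + 1 + 1)))) := by
      rw [boundaryFactor, triangle_succ (N + 1)]
      push_cast
      ring_nf
    rw [← h2, ← boundaryFactor, ← jacobiFactor] at h
    simp only [Finset.prod_Ico_succ_top (Nat.succ_le_succ (Nat.zero_le N))]
    linear_combination (∏ i ∈ Finset.Ico 1 (N + 1), latticeFactor (fun i => r i + i * m i) i) * h +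
      latticeFactor r (N + 1) * jacobiFactor r (N + 1) (m (N + 1) - m (N + 1 + 1)) * ih

/-- Only the two end corrections survive the telescoping: the upper one is 1 because `m (N + 1) =
0`, and the lower one is `a_0^{m_1}`, which cancels the leading power of `a_0` because `r 1 = 0`. -/
theorem lattice_eq_prod_jacobiFactor (r m : ℕ → ℤ) (N : ℕ) (hr : r 1 = 0) (hm : m (N + 1) = 0) :
    aPow 0 (-(r 1 + m 1)) *
        ∏ i ∈ Finset.Ico 1 (N + 1), latticeFactor (fun i => r i + i * m i) i =
      ∏ i ∈ Finset.Ico 1 (N + 1), (latticeFactor r i * jacobiFactor r i (m i - m (i + 1))) := by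
  have h := prod_latticeFactor r m N
  have h1 : boundaryFactor r m (N + 1) = 1 := by
    simp [boundaryFactor, hm, aPow_zero, qPow_zero]
  have h2 : boundaryFactor r m 1 = aPow 0 (m 1) := by
    simp [boundaryFactor, triangle, qPow_zero]
  have h3 : aPow 0 (-(r 1 + m 1)) * aPow 0 (m 1) = 1 := by
    rw [← aPow_add, hr]
    simp [aPow_zero]
  rw [h1, h2, mul_one] at h
  rw [h, mul_left_comm, h3, mul_one]

/-- Two Pochhammer symbols of the `i`-th factor of `residueTerm`. -/
noncomputable def pochhammerPair (r : ℕ → ℤ) (i : ℕ) : QSeries :=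
  qPochhammer (-((∏ l ∈ Finset.range i, (aPow i 1 * aPow l (-1))) *
    qPow ((i : ℤ) * (i + 1) / 2 + (i + 1) * r i - i * r (i + 1)))) (i * (i + 1)) *
  qPochhammer (-((∏ l ∈ Finset.range i, (aPow l 1 * aPow i (-1))) *
    qPow ((i : ℤ) * (i + 1) / 2 - (i + 1) * r i + i * r (i + 1)))) (i * (i + 1))

theorem hasSum_jacobiFactor (r : ℕ → ℤ) {i : ℕ} (hi : 0 < i) :
    HasSum (jacobiFactor r i)
      (pochhammerPair r i * qPochhammer (qPow ((i : ℤ) * (i + 1))) (i * (i + 1))) := by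
  have he : 0 < triangle i := by
    have := two_mul_triangle i
    nlinarith
  have he2 : ((i : ℤ) * (i + 1)) / 2 = triangle i := by
    have : ((2 * triangle i : ℕ) : ℤ) = i * (i + 1) := by exact_mod_cast two_mul_triangle i
    omega
  refine (hasSum_jacobi he (ratioPow_zero i _) (ratioPow_add i
    ((i + 1) * r i - i * r (i + 1)))).of_eq (fun _ => rfl) ?_
  have h1 : ratioPow i ((i + 1) * r i - i * r (i + 1)) 1 * qPow (triangle i) =
      (∏ l ∈ Finset.range i, (aPow i 1 * aPow l (-1))) *
        qPow (triangle i + (i + 1) * r i - i * r (i + 1)) := by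
    rw [ratioPow, mul_assoc, ← qPow_add]
    congr 2
    ring
  have h2 : ratioPow i ((i + 1) * r i - i * r (i + 1)) (-1) * qPow (triangle i) =
      (∏ l ∈ Finset.range i, (aPow l 1 * aPow i (-1))) *
        qPow (triangle i - (i + 1) * r i + i * r (i + 1)) := by
    rw [ratioPow, mul_assoc, ← qPow_add]
    simp only [neg_neg, mul_comm (aPow i (-1))]
    congr 2
    ring
  rw [h1, h2, pochhammerPair, he2, two_mul_triangle]
  push_cast
  rfl

theorem _root_.Summable.prod_of_finite {β γ : Type*} [Finite β] {f : β × γ → QSeries}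
    (h : ∀ b, Summable fun c => f (b, c)) : Summable f :=
  summable_of_finite fun N =>
    (Set.finite_iUnion fun b => (finite_of_summable (h b) N).image (Prod.mk b)).subset
      fun x hx => Set.mem_iUnion.2 ⟨x.1, x.2, hx, rfl⟩

theorem _root_.HasSum.prod_of_fintype {β γ : Type*} [Fintype β] {f : β × γ → QSeries}
    {g : β → QSeries} (h : ∀ b, HasSum (fun c => f (b, c)) (g b)) : HasSum f (∑ b, g b) := by
  have h1 := (Summable.prod_of_finite fun b => (h b).summable).hasSum
  rw [← (h1.prod_fiberwise h).unique (hasSum_fintype g)]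
  exact h1

theorem toSeq_succ {N : ℕ} (s : Fin N → ℤ) (j : Fin N) : toSeq s (j + 1) = s j := by
  rw [toSeq, dif_pos ⟨by omega, by omega⟩]
  rfl

theorem toSeq_of_lt {N : ℕ} (s : Fin N → ℤ) {i : ℕ} (hi : N < i) : toSeq s i = 0 :=
  dif_neg (by omega)

theorem prod_Ico_one_eq {M : Type*} [CommMonoid M] (N : ℕ) (f : ℕ → M) :
    ∏ i ∈ Finset.Ico 1 (N + 1), f i = ∏ j : Fin N, f (j + 1) := by
  rw [Finset.prod_Ico_eq_prod_range, Fin.prod_univ_eq_prod_range (fun k => f (k + 1))]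
  simp [add_comm]

/-- A sequence `m_1, …, m_N` and its differences `m_i - m_{i+1}`, where `m_{N+1} = 0`. -/
def differenceEquiv (N : ℕ) : (Fin N → ℤ) ≃ (Fin N → ℤ) where
  toFun m j := m j - toSeq m (j + 2)
  invFun p j := ∑ k ∈ Finset.Ico ((j : ℕ) + 1) (N + 1), toSeq p k
  left_inv m := by
    funext j
    have : ∀ k ∈ Finset.Ico ((j : ℕ) + 1) (N + 1),
        toSeq (fun j : Fin N => m j - toSeq m (j + 2)) k = -(toSeq m (k + 1) - toSeq m k) := by
      intro k hk
      rw [Finset.mem_Ico] at hk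
      obtain ⟨k, rfl⟩ := Nat.exists_eq_add_of_le' (show 1 ≤ k by omega)
      have h1 := toSeq_succ (fun j : Fin N => m j - toSeq m (j + 2)) ⟨k, by omega⟩
      have h2 := toSeq_succ m ⟨k, by omega⟩
      simp only at h1 h2
      rw [h1, h2, neg_sub]
    change ∑ k ∈ Finset.Ico ((j : ℕ) + 1) (N + 1),
      toSeq (fun j : Fin N => m j - toSeq m (j + 2)) k = m j
    rw [Finset.sum_congr rfl this, Finset.sum_neg_distrib, Finset.sum_Ico_sub _ (by omega),
      toSeq_succ, toSeq_of_lt m (Nat.lt_succ_self N)]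
    ring
  right_inv p := by
    funext j
    have h1 : ∑ k ∈ Finset.Ico ((j : ℕ) + 1) (N + 1), toSeq p k =
        p j + ∑ k ∈ Finset.Ico ((j : ℕ) + 2) (N + 1), toSeq p k := by
      rw [Finset.sum_eq_sum_Ico_succ_bot (by omega), toSeq_succ]
    have h2 : toSeq (fun j : Fin N => ∑ k ∈ Finset.Ico ((j : ℕ) + 1) (N + 1), toSeq p k) (j + 2) =
        ∑ k ∈ Finset.Ico ((j : ℕ) + 2) (N + 1), toSeq p k := by
      by_cases hj : (j : ℕ) + 1 < N
      · exact toSeq_succ _ ⟨(j : ℕ) + 1, hj⟩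
      · rw [toSeq_of_lt _ (by omega), Finset.Ico_eq_empty (by omega), Finset.sum_empty]
    simp only
    rw [h1, h2]
    ring

/-- `s_i = r_i + i m_i` with `0 ≤ r_i < i`. -/
def residueEquiv (N : ℕ) : (Fin N → ℤ) ≃ ((j : Fin N) → Fin (j.val + 1)) × (Fin N → ℤ) :=
  (Equiv.piCongrRight fun j : Fin N => (Int.divModEquiv (j.val + 1)).trans
    (Equiv.prodComm _ _)).trans
      (Equiv.arrowProdEquivProdArrow _ (fun j : Fin N => Fin (j.val + 1)) fun _ => ℤ)

theorem residueEquiv_symm_apply (N : ℕ) (r : (j : Fin N) → Fin (j.val + 1)) (m : Fin N → ℤ)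
    (j : Fin N) : (residueEquiv N).symm (r, m) j = (r j : ℕ) + (j + 1) * m j := by
  have : (residueEquiv N).symm (r, m) j = (Int.divModEquiv (j.val + 1)).symm (m j, r j) := rfl
  rw [this, Int.divModEquiv_symm_apply]
  push_cast
  ring

/-- `∑ a_0^{-s_1} ∏ a_i^{s_i - s_{i+1}} q^{s_i (s_i - s_{i+1})}` as a finite sum of products. -/
theorem hasSum_latticeTerm (N : ℕ) :
    HasSum (latticeTerm (N + 1))
      ((∏ i ∈ Finset.Ico 1 (N + 1), qPochhammer (qPow ((i : ℤ) * (i + 1))) (i * (i + 1))) *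
        ∑ r : (j : Fin N) → Fin (j.val + 1), residueTerm (N + 1) fun j => ((r j : ℕ) : ℤ)) := by
  -- From residues and differences `(r, p)` to `(r, m)`, and then to `s_i = r_i + i m_i`.
  set e := ((Equiv.refl _).prodCongr (differenceEquiv N)).symm.trans (residueEquiv N).symm with he
  have hterm : ∀ (r : (j : Fin N) → Fin (j.val + 1)) (p : Fin N → ℤ),
      latticeTerm (N + 1) (e (r, p)) =
        (∏ i ∈ Finset.Ico 1 (N + 1), latticeFactor (toSeq fun j => ((r j : ℕ) : ℤ)) i) *
          ∏ j : Fin N, jacobiFactor (toSeq fun j => ((r j : ℕ) : ℤ)) (j + 1) (p j) := by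
    intro r p
    set R := toSeq fun j => ((r j : ℕ) : ℤ) with hR
    set m := (differenceEquiv N).symm p with hm
    have hp : ∀ j, p j = m j - toSeq m (j + 2) := fun j =>
      (congrFun ((differenceEquiv N).apply_symm_apply p) j).symm
    have hs : toSeq (e (r, p)) = fun i : ℕ => R i + i * toSeq m i := by
      funext i
      by_cases hi : 1 ≤ i ∧ i ≤ N
      · obtain ⟨i, rfl⟩ := Nat.exists_eq_add_of_le' hi.1
        have h1 := toSeq_succ (e (r, p)) ⟨i, by omega⟩
        have h2 := toSeq_succ (fun j => ((r j : ℕ) : ℤ)) ⟨i, by omega⟩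
        have h3 := toSeq_succ m ⟨i, by omega⟩
        simp only at h1 h2 h3
        rw [h1, hR, h2, h3]
        push_cast
        exact residueEquiv_symm_apply N r m ⟨i, by omega⟩
      · rw [hR, toSeq, toSeq, toSeq, dif_neg hi, dif_neg hi, dif_neg hi]
        simp
    -- The residue `r_1` is taken modulo 1.
    have hR1 : R 1 = 0 := by
      rw [hR, toSeq]
      split_ifs with h
      · have := (r ⟨1 - 1, by omega⟩).isLt
        simp only at this ⊢
        omega
      · rfl
    have h := lattice_eq_prod_jacobiFactor R (toSeq m) N hR1 (toSeq_of_lt m (Nat.lt_succ_self N))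
    rw [Finset.prod_mul_distrib, prod_Ico_one_eq N fun i => jacobiFactor R i _] at h
    have h4 : ∀ j : Fin N, jacobiFactor R (j + 1) (toSeq m (j + 1) - toSeq m (j + 1 + 1)) =
        jacobiFactor R (j + 1) (p j) := fun j => by rw [toSeq_succ, hp]
    rw [Finset.prod_congr rfl fun j _ => h4 j] at h
    rw [← h]
    change aPow 0 (-toSeq (e (r, p)) 1) *
      ∏ i ∈ Finset.Ico 1 (N + 1), latticeFactor (toSeq (e (r, p))) i = _
    rw [hs]
    simp
  refine (e.hasSum_iff (f := (latticeTerm (N + 1) : (Fin N → ℤ) → QSeries))).1 ?_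
  -- For fixed residues the differences `p_i` range independently over `ℤ`, so the sum is a product
  -- of one-dimensional theta series.
  have hr : ∀ r : (j : Fin N) → Fin (j.val + 1), HasSum (fun p => latticeTerm (N + 1) (e (r, p)))
      ((∏ i ∈ Finset.Ico 1 (N + 1), qPochhammer (qPow ((i : ℤ) * (i + 1))) (i * (i + 1))) *
        residueTerm (N + 1) fun j => ((r j : ℕ) : ℤ)) := by
    intro r
    set R := toSeq fun j => ((r j : ℕ) : ℤ) with hR
    have h1 := hasSum_pi_prod N (fun j : Fin N => jacobiFactor R (j + 1))
      fun j => (hasSum_jacobiFactor R (Nat.succ_pos j)).summable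
    have h2 := h1.mul_left (∏ i ∈ Finset.Ico 1 (N + 1), latticeFactor R i)
    refine h2.of_eq (hterm r) ?_
    have h4 : ∀ j : Fin N, ∑' p, jacobiFactor R (j + 1) p = _ :=
      fun j => (hasSum_jacobiFactor R (Nat.succ_pos j)).tsum_eq
    rw [Finset.prod_congr rfl fun j _ => h4 j]
    simp only [Nat.succ_eq_add_one]
    rw [← prod_Ico_one_eq N fun i => pochhammerPair R i * qPochhammer (qPow ((i : ℤ) * (i + 1))) (i * (i + 1)),
      Finset.prod_mul_distrib]
    have h3 : residueTerm (N + 1) (fun j => ((r j : ℕ) : ℤ)) =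
        (∏ i ∈ Finset.Ico 1 (N + 1), latticeFactor R i) *
          ∏ i ∈ Finset.Ico 1 (N + 1), pochhammerPair R i := by
      rw [← Finset.prod_mul_distrib]
      exact Finset.prod_congr rfl fun i _ => mul_assoc _ _ _
    rw [h3]
    ring
  rw [Finset.mul_sum]
  exact HasSum.prod_of_fintype hr

/-! ### The recursion for generalised Primc partitions, solved by products of rows -/

/-- The relations between the generating functions `r i t` and `c k t` of the first and of the
second rows of length `t`, where `A i` and `B i` are the variables of the two rows. -/
structure RowSystem (n : ℕ) (A B : ℕ → QSeries) (r c : ℕ → ℕ → QSeries) : Prop where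
  mul_eq_one : ∀ i, A i * B i = 1
  r_zero : ∀ i, r i 0 = 1
  c_zero : ∀ k, c k 0 = 1
  r_succ : ∀ i t, i < n → r (i + 1) (t + 1) = r i (t + 1) + A i * r i t
  c_succ : ∀ k t, k < n → c k (t + 1) = c (k + 1) (t + 1) + B k * c (k + 1) t
  r_periodic : ∀ t : ℕ, r 0 t = qPow t * r n t
  c_periodic : ∀ t : ℕ, c n t = qPow t * c 0 t

/-- `∑_v (q)_t / (q)_{t-v} r_{i,v} c_{k,v}`. -/
noncomputable def hPlus (r c : ℕ → ℕ → QSeries) (t i k : ℕ) : QSeries :=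
  ∑ v ∈ Finset.range (t + 1), qFall 1 t v * (r i v * c k v)

/-- `∑_v q^{t-v} (q)_t / (q)_{t-v} r_{i,v} c_{k,v}`. -/
noncomputable def hMinus (r c : ℕ → ℕ → QSeries) (t i k : ℕ) : QSeries :=
  ∑ v ∈ Finset.range (t + 1), qPow (t - v) * (qFall 1 t v * (r i v * c k v))

/-- `hPlus` on and below the diagonal, `hMinus` above it. -/
noncomputable def hMixed (r c : ℕ → ℕ → QSeries) (t i k : ℕ) : QSeries :=
  if k ≤ i then hPlus r c t i k else hMinus r c t i k

theorem qFall_one_succ_succ (t v : ℕ) :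
    qFall 1 (t + 1) (v + 1) = (1 - qPow ((t + 1 : ℕ) : ℤ)) * qFall 1 t v := by
  rw [qFall_succ_succ]
  push_cast
  rw [one_mul]

theorem sum_Ico_ite_mul_sub (g : ℕ → QSeries) (Q : QSeries) (i a b : ℕ) (hab : a ≤ b) :
    ∑ x ∈ Finset.Ico a b, (if i ≤ x then Q else 1) * (g (x + 1) - g x) =
      (g (max a (min i b)) - g a) + Q * (g b - g (max a (min i b))) := by
  induction b, hab using Nat.le_induction with
  | base =>
    simp
  | succ b hb ih =>
    rw [Finset.sum_Ico_succ_top hb, ih]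
    split_ifs with h
    · have h1 : max a (min i (b + 1)) = max a (min i b) := by omega
      rw [h1]
      ring
    · have h1 : max a (min i (b + 1)) = b + 1 := by omega
      have h2 : max a (min i b) = b := by omega
      rw [h1, h2]
      ring

namespace RowSystem

variable {n : ℕ} {A B : ℕ → QSeries} {r c : ℕ → ℕ → QSeries}

/-- The mixed second difference factors: `(r_{i+1} - r_i)(c_k - c_{k+1})` at length `v + 1` is `A_i
B_k r_i c_{k+1}` at length `v`. The terms of length 0 cancel, and the shift of `v` in `qFall`
produces `1 - q^{t+1}`. -/
theorem mul_hPlus (h : RowSystem n A B r c) {i k : ℕ} (t : ℕ) (hi : i < n) (hk : k < n) :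
    (1 - qPow ((t + 1 : ℕ) : ℤ)) * (A i * B k * hPlus r c t i (k + 1)) =
      hPlus r c (t + 1) (i + 1) k - hPlus r c (t + 1) i k -
        hPlus r c (t + 1) (i + 1) (k + 1) + hPlus r c (t + 1) i (k + 1) := by
  simp only [hPlus, Finset.sum_range_succ' _ (t + 1), h.r_zero, h.c_zero, Finset.mul_sum]
  have hcancel : ∀ a b c d x : QSeries, a + x - (b + x) - (c + x) + (d + x) = a - b - c + d := by
    intros
    ring
  rw [hcancel, ← Finset.sum_sub_distrib, ← Finset.sum_sub_distrib, ← Finset.sum_add_distrib]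
  refine Finset.sum_congr rfl fun v _ => ?_
  rw [qFall_one_succ_succ, h.r_succ i v hi, h.c_succ k v hk]
  ring

theorem mul_hMinus (h : RowSystem n A B r c) {i k : ℕ} (t : ℕ) (hi : i < n) (hk : k < n) :
    (1 - qPow ((t + 1 : ℕ) : ℤ)) * (A i * B k * hMinus r c t i (k + 1)) =
      hMinus r c (t + 1) (i + 1) k - hMinus r c (t + 1) i k -
        hMinus r c (t + 1) (i + 1) (k + 1) + hMinus r c (t + 1) i (k + 1) := by
  simp only [hMinus, Finset.sum_range_succ' _ (t + 1), h.r_zero, h.c_zero, Finset.mul_sum]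
  have hcancel : ∀ a b c d x : QSeries, a + x - (b + x) - (c + x) + (d + x) = a - b - c + d := by
    intros
    ring
  rw [hcancel, ← Finset.sum_sub_distrib, ← Finset.sum_sub_distrib, ← Finset.sum_add_distrib]
  refine Finset.sum_congr rfl fun v _ => ?_
  have : ((t + 1 : ℕ) : ℤ) - (v + 1 : ℕ) = t - v := by push_cast; ring
  rw [qFall_one_succ_succ, h.r_succ i v hi, h.c_succ k v hk, this]
  ring

/-- The factor `q^v` from the periodicity of the rows completes the weight `q^{t-v}` of `hMinus` to
`q^t`. So moving across the boundary of the index square exchanges `hMinus` and `hPlus`. -/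
theorem hMinus_zero (h : RowSystem n A B r c) (t k : ℕ) :
    hMinus r c t 0 k = qPow t * hPlus r c t n k := by
  rw [hMinus, hPlus, Finset.mul_sum]
  refine Finset.sum_congr rfl fun v _ => ?_
  rw [h.r_periodic, ← sub_add_cancel (t : ℤ) v, qPow_add, sub_add_cancel]
  ring

theorem hMinus_last (h : RowSystem n A B r c) (t i : ℕ) :
    hMinus r c t i n = qPow t * hPlus r c t i 0 := by
  rw [hMinus, hPlus, Finset.mul_sum]
  refine Finset.sum_congr rfl fun v _ => ?_
  rw [h.c_periodic, ← sub_add_cancel (t : ℤ) v, qPow_add, sub_add_cancel]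
  ring

end RowSystem

/-- The factor `1 - q^{t+1-v}` extends the falling product `(q)_{t+1} / (q)_{t+1-v}` by one step and
kills the term `v = t + 1`. -/
theorem hPlus_sub_hMinus (r c : ℕ → ℕ → QSeries) (t i k : ℕ) :
    hPlus r c (t + 1) i k - hMinus r c (t + 1) i k =
      (1 - qPow ((t + 1 : ℕ) : ℤ)) * hPlus r c t i k := by
  rw [hPlus, hMinus, ← Finset.sum_sub_distrib, Finset.sum_range_succ, hPlus, Finset.mul_sum,
    sub_self, qPow_zero, one_mul, sub_self, add_zero]
  refine Finset.sum_congr rfl fun v _ => ?_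
  have h1 := qFall_one_succ_succ t v
  rw [qFall_succ] at h1
  push_cast at h1 ⊢
  rw [one_mul] at h1
  linear_combination (r i v * c k v) * h1

namespace RowSystem

variable {n : ℕ} {A B : ℕ → QSeries} {r c : ℕ → ℕ → QSeries}

/-- The inner sum of the Primc recursion, over the first index `i'` of the colour of the removed
part. Off the diagonal the second-difference identities make the summands consecutive differences,
of `hMinus` for `i' < k'` and of `hPlus` for `i' > k'`. The diagonal term, where `A k' * B k' = 1`,
is the difference `hPlus - hMinus` and joins the two chains. Both sides keep the factor `1 -
q^{t+1}`, which all these identities carry. -/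
theorem row_sum (h : RowSystem n A B r c) {i k' : ℕ} (t : ℕ) (hi : i < n) (hk : k' < n) :
    (1 - qPow ((t + 1 : ℕ) : ℤ)) * ∑ i' ∈ Finset.range n,
      (if i ≤ i' ∧ ¬ (i' = k' ∧ k' = i) then qPow ((t + 1 : ℕ) : ℤ) else 1) *
        (A i' * B k' * hMixed r c t i' (if i' = k' then k' else k' + 1)) =
      (1 - qPow ((t + 1 : ℕ) : ℤ)) * (hMixed r c (t + 1) i k' - hMixed r c (t + 1) i (k' + 1)) := by
  set Q := qPow ((t + 1 : ℕ) : ℤ) with hQ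
  set gp : ℕ → QSeries := fun x => hPlus r c (t + 1) x k' - hPlus r c (t + 1) x (k' + 1) with hgp
  set gm : ℕ → QSeries := fun x => hMinus r c (t + 1) x k' - hMinus r c (t + 1) x (k' + 1) with hgm
  have hlow : ∀ i' ∈ Finset.Ico 0 k', (1 - Q) *
      ((if i ≤ i' ∧ ¬ (i' = k' ∧ k' = i) then Q else 1) *
        (A i' * B k' * hMixed r c t i' (if i' = k' then k' else k' + 1))) =
      (if i ≤ i' then Q else 1) * (gm (i' + 1) - gm i') := by
    intro i' hi'
    rw [Finset.mem_Ico] at hi'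
    have h1 : (i ≤ i' ∧ ¬ (i' = k' ∧ k' = i)) ↔ i ≤ i' := by omega
    simp only [h1]
    rw [if_neg (show i' ≠ k' by omega), hMixed, if_neg (show ¬ k' + 1 ≤ i' by omega), mul_left_comm,
      h.mul_hMinus t (by omega) hk]
    simp only [hgm]
    ring
  have hhigh : ∀ i' ∈ Finset.Ico (k' + 1) n, (1 - Q) *
      ((if i ≤ i' ∧ ¬ (i' = k' ∧ k' = i) then Q else 1) *
        (A i' * B k' * hMixed r c t i' (if i' = k' then k' else k' + 1))) =
      (if i ≤ i' then Q else 1) * (gp (i' + 1) - gp i') := by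
    intro i' hi'
    rw [Finset.mem_Ico] at hi'
    have h1 : (i ≤ i' ∧ ¬ (i' = k' ∧ k' = i)) ↔ i ≤ i' := by omega
    simp only [h1]
    rw [if_neg (show i' ≠ k' by omega), hMixed, if_pos (show k' + 1 ≤ i' by omega), mul_left_comm,
      h.mul_hPlus t (by omega) hk]
    simp only [hgp]
    ring
  have hdiag : (1 - Q) * ((if i ≤ k' ∧ ¬ (k' = k' ∧ k' = i) then Q else 1) *
        (A k' * B k' * hMixed r c t k' (if k' = k' then k' else k' + 1))) =
      (if i < k' then Q else 1) * (hPlus r c (t + 1) k' k' - hMinus r c (t + 1) k' k') := by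
    have h1 : (i ≤ k' ∧ ¬ (k' = k' ∧ k' = i)) ↔ i < k' := by omega
    have e1 : (if k' = k' then k' else k' + 1) = k' := if_pos rfl
    have e2 : (if i ≤ k' ∧ ¬ (k' = k' ∧ k' = i) then Q else 1) = if i < k' then Q else 1 :=
      if_congr h1 rfl rfl
    rw [e1, e2, hMixed, if_pos le_rfl, h.mul_eq_one, one_mul, hPlus_sub_hMinus]
    ring
  -- Compatibility of the two chains at the diagonal: the second-difference identity at `i = k = k'`
  -- and `hPlus_sub_hMinus` at `(k', k' + 1)` have the same left side.
  have hcorner : hPlus r c (t + 1) (k' + 1) k' - hPlus r c (t + 1) k' k' -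
      hPlus r c (t + 1) (k' + 1) (k' + 1) + hMinus r c (t + 1) k' (k' + 1) = 0 := by
    have h1 := h.mul_hPlus t hk hk
    rw [h.mul_eq_one, one_mul, ← hPlus_sub_hMinus] at h1
    linear_combination -h1
  -- The start of the lower chain is `Q` times the end of the upper one, so the terms at `0` and `n`
  -- cancel.
  have hper : gm 0 = Q * gp n := by
    simp only [hgm, hgp, h.hMinus_zero]
    ring
  rw [Finset.mul_sum, ← Nat.Ico_zero_eq_range, ← Finset.sum_Ico_consecutive _ (Nat.zero_le k') hk.le,
    Finset.sum_eq_sum_Ico_succ_bot hk, Finset.sum_congr rfl hlow, Finset.sum_congr rfl hhigh, hdiag,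
    sum_Ico_ite_mul_sub _ _ _ _ _ (Nat.zero_le k'), sum_Ico_ite_mul_sub _ _ _ _ _ hk]
  -- The weight changes from 1 to `Q` at index `i`, which lies in the lower chain, at the diagonal,
  -- or in the upper chain.
  rcases lt_trichotomy i k' with hlt | heq | hgt
  · have e1 : max 0 (min i k') = i := by omega
    have e2 : max (k' + 1) (min i n) = k' + 1 := by omega
    rw [e1, e2, if_pos hlt, hMixed, hMixed, if_neg (by omega), if_neg (by omega), hper]
    simp only [hgm, hgp]
    linear_combination (-Q) * hcorner
  · subst heq
    have e1 : max 0 (min i i) = i := by omega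
    have e2 : max (i + 1) (min i n) = i + 1 := by omega
    rw [e1, e2, if_neg (by omega), hMixed, hMixed, if_pos le_rfl, if_neg (by omega), hper]
    simp only [hgm, hgp]
    linear_combination (-Q) * hcorner
  · have e1 : max 0 (min i k') = k' := by omega
    have e2 : max (k' + 1) (min i n) = i := by omega
    rw [e1, e2, if_neg (by omega), hMixed, hMixed, if_pos (by omega), if_pos (by omega), hper]
    simp only [hgm, hgp]
    linear_combination (-1 : QSeries) * hcorner

/-- The outer telescoping, over `k'`: with weight `Q` below `κ` and 1 from `κ` on, the differences
sum to `Q (h_0 - h_κ) + h_κ - h_n`, where `h_k = hMixed r c (t + 1) i k`. This is `(1 - Q) h_κ`,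
because `h_n = Q h_0`. -/
theorem sum_hMixed (h : RowSystem n A B r c) {i κ : ℕ} (t : ℕ) (hi : i < n) (hκ : κ ≤ n) :
    ∑ k' ∈ Finset.range n, (if k' < κ then qPow ((t + 1 : ℕ) : ℤ) else 1) *
      ∑ i' ∈ Finset.range n,
      (if i ≤ i' ∧ ¬ (i' = k' ∧ k' = i) then qPow ((t + 1 : ℕ) : ℤ) else 1) *
        (A i' * B k' * hMixed r c t i' (if i' = k' then k' else k' + 1)) =
      (1 - qPow ((t + 1 : ℕ) : ℤ)) * hMixed r c (t + 1) i κ := by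
  have hunit : IsUnit (1 - qPow ((t + 1 : ℕ) : ℤ)) := by
    refine isUnit_of_ordGE_sub_one ?_
    rw [sub_sub_cancel_left]
    exact ((ordGE_qPow _).mono (by push_cast; omega)).neg
  refine hunit.mul_left_cancel ?_
  set Q := qPow ((t + 1 : ℕ) : ℤ) with hQ
  -- The weights are in the opposite order to those of `sum_Ico_ite_mul_sub`; subtracting that
  -- weight from the constant `1 + Q` exchanges `Q` and 1.
  have key : ∀ k' ∈ Finset.range n, (1 - Q) * ((if k' < κ then Q else 1) *
      ∑ i' ∈ Finset.range n,
      (if i ≤ i' ∧ ¬ (i' = k' ∧ k' = i) then Q else 1) *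
        (A i' * B k' * hMixed r c t i' (if i' = k' then k' else k' + 1))) =
      (1 - Q) * (((if κ ≤ k' then Q else 1) + (-1 - Q)) *
        (hMixed r c (t + 1) i (k' + 1) - hMixed r c (t + 1) i k')) := by
    intro k' hk'
    rw [mul_left_comm, h.row_sum t hi (Finset.mem_range.1 hk')]
    rcases lt_or_ge k' κ with h1 | h1
    · rw [if_pos h1, if_neg (by omega)]
      ring
    · rw [if_neg (by omega), if_pos h1]
      ring
  rw [Finset.mul_sum, Finset.sum_congr rfl key, ← Finset.mul_sum]
  simp only [add_mul]
  rw [Finset.sum_add_distrib, ← Finset.mul_sum, Finset.sum_range_sub, ← Nat.Ico_zero_eq_range,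
    sum_Ico_ite_mul_sub _ _ _ _ _ (Nat.zero_le n)]
  have e1 : max 0 (min κ n) = κ := by omega
  have e2 : hMixed r c (t + 1) i n = Q * hMixed r c (t + 1) i 0 := by
    rw [hMixed, hMixed, if_neg (by omega), if_pos (Nat.zero_le _), h.hMinus_last]
  rw [e1, e2]
  ring

end RowSystem

/-! ### Generating functions of lists with difference conditions -/

/-- The parts, from the smallest to the largest, of a partition with coloured parts: the smallest
part is at least `δ` of its colour, and a part of colour `c'` exceeds a preceding (smaller) part
of colour `c` by at least `D c' c`. -/
def IsLadder {K : Type*} (D : K → K → ℕ) : (K → ℕ) → List (ℕ × K) → Prop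
  | _, [] => True
  | δ, x :: l => δ x.2 ≤ x.1 ∧ IsLadder D (fun c => D c x.2 + x.1) l

theorem isLadder_cons {K : Type*} {D : K → K → ℕ} {δ : K → ℕ} {x : ℕ × K} {l : List (ℕ × K)} :
    IsLadder D δ (x :: l) ↔ δ x.2 ≤ x.1 ∧ IsLadder D (fun c => D c x.2 + x.1) l := Iff.rfl

theorem isLadder_iff {K : Type*} {D : K → K → ℕ} {δ : K → ℕ} {l : List (ℕ × K)} :
    IsLadder D δ l ↔
      (∀ x ∈ l.head?, δ x.2 ≤ x.1) ∧ l.IsChain fun x y => D y.2 x.2 + x.1 ≤ y.1 := by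
  induction l generalizing δ with
  | nil => simp [IsLadder]
  | cons x l ih => rw [isLadder_cons, ih, List.isChain_cons]; simp

/-- The product of the weights of the parts. -/
noncomputable def ladderWeight {K : Type*} (w : K → QSeries) (l : List (ℕ × K)) : QSeries :=
  (l.map fun x => w x.2 * qPow x.1).prod

theorem ladderWeight_cons {K : Type*} (w : K → QSeries) (x : ℕ × K) (l : List (ℕ × K)) :
    ladderWeight w (x :: l) = w x.2 * qPow x.1 * ladderWeight w l := by
  simp [ladderWeight]

theorem ordGE_ladderWeight {K : Type*} {w : K → QSeries} (hw : ∀ c, OrdGE 0 (w c))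
    (l : List (ℕ × K)) : OrdGE ((l.map Prod.fst).sum : ℕ) (ladderWeight w l) := by
  induction l with
  | nil => simpa [ladderWeight] using ordGE_one
  | cons x l ih =>
    rw [ladderWeight_cons]
    refine (((hw x.2).mul (ordGE_qPow x.1)).mul ih).mono ?_
    simp

/-- The ladders with `t` parts. -/
abbrev Ladder {K : Type*} (D : K → K → ℕ) (t : ℕ) (δ : K → ℕ) : Type _ :=
  {l : List (ℕ × K) // l.length = t ∧ IsLadder D δ l}

/-- The generating function of the ladders with `t` parts. -/
noncomputable def ladderSum {K : Type*} (D : K → K → ℕ) (w : K → QSeries) (t : ℕ) (δ : K → ℕ) :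
    QSeries :=
  ∑' l : Ladder D t δ, ladderWeight w l.1

/-- Cutting off the smallest part. -/
def ladderConsEquiv {K : Type*} (D : K → K → ℕ) (t : ℕ) (δ : K → ℕ) :
    (Σ x : K × ℕ, Ladder D t fun c => D c x.1 + (δ x.1 + x.2)) ≃ Ladder D (t + 1) δ where
  toFun y := ⟨(δ y.1.1 + y.1.2, y.1.1) :: y.2.1, by
    refine ⟨by simp [y.2.2.1], isLadder_cons.2 ⟨Nat.le_add_right _ _, y.2.2.2⟩⟩⟩
  invFun l := match l with
    | ⟨[], h⟩ => absurd h.1 (by simp)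
    | ⟨x :: l, h⟩ => ⟨(x.2, x.1 - δ x.2), ⟨l, by simpa using h.1, by
        have h1 := isLadder_cons.1 h.2
        have h2 : δ x.2 + (x.1 - δ x.2) = x.1 := Nat.add_sub_cancel' h1.1
        rw [h2]
        exact h1.2⟩⟩
  left_inv := by
    rintro ⟨⟨c, g⟩, l, hl⟩
    have : δ c + g - δ c = g := Nat.add_sub_cancel_left _ _
    simp only
    congr 1
    · rw [this]
    · congr 1
      · rw [this]
      · simp
  right_inv := by
    rintro ⟨_ | ⟨x, l⟩, h⟩
    · simp at h
    · have h1 := isLadder_cons.1 h.2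
      have h2 : δ x.2 + (x.1 - δ x.2) = x.1 := Nat.add_sub_cancel' h1.1
      simp [h2]

theorem ladderSum_zero {K : Type*} {D : K → K → ℕ} {w : K → QSeries} (δ : K → ℕ) : ladderSum D w 0 δ = 1 := by
  rw [ladderSum, tsum_eq_single (⟨[], rfl, trivial⟩ : Ladder D 0 δ)
    fun l hl => absurd (Subtype.ext (List.length_eq_zero_iff.1 l.2.1)) hl]
  simp [ladderWeight]

theorem ordGE_ladderSum {K : Type*} {D : K → K → ℕ} {w : K → QSeries}
    (hw : ∀ c, OrdGE 0 (w c)) (t : ℕ) (δ : K → ℕ) :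
    OrdGE 0 (ladderSum D w t δ) :=
  ordGE_tsum fun l => (ordGE_ladderWeight hw l.1).mono (by positivity)

theorem hasSum_geometric {t : ℕ} (ht : 0 < t) :
    ∃ x, HasSum (fun g : ℕ => qPow (t * g)) x ∧ (1 - qPow t) * x = 1 := by
  have hs : Summable fun g : ℕ => qPow (t * g) := summable_of_ordGE (fun g => (t * g : ℤ))
    (fun g => ordGE_qPow _) fun N => (Set.finite_Iic N.toNat).subset fun g hg => by
      simp only [Set.mem_ofPred_eq, Set.mem_Iic] at hg ⊢
      have : (g : ℤ) ≤ t * g := by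
        have : (1 : ℤ) ≤ t := by exact_mod_cast ht
        nlinarith [Int.natCast_nonneg g]
      omega
  refine ⟨_, hs.hasSum, ?_⟩
  have h1 := hs.tsum_eq_zero_add
  have h2 : ∀ g : ℕ, qPow (t * (g + 1 : ℕ)) = qPow t * qPow (t * g) := fun g => by
    rw [← qPow_add]
    congr 1
    push_cast
    ring
  rw [tsum_congr h2, hs.tsum_mul_left] at h1
  simp only [Nat.cast_zero, mul_zero, qPow_zero] at h1
  linear_combination h1

theorem isUnit_one_sub_qPow_succ (t : ℕ) : IsUnit (1 - qPow ((t + 1 : ℕ) : ℤ)) := by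
  refine isUnit_of_ordGE_sub_one ?_
  rw [sub_sub_cancel_left]
  exact ((ordGE_qPow _).mono (by push_cast; omega)).neg

section

variable {K : Type*} [Fintype K] {D : K → K → ℕ} {w : K → QSeries}

theorem summable_ladder (hw : ∀ c, OrdGE 0 (w c)) (t : ℕ) (δ : K → ℕ) :
    Summable fun l : Ladder D t δ => ladderWeight w l.1 := by
  refine summable_of_ordGE (fun l => ((l.1.map Prod.fst).sum : ℕ))
    (fun l => ordGE_ladderWeight hw l.1) fun N => ?_
  have hs : {x : ℕ × K | x.1 < N.toNat}.Finite :=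
    ((Set.finite_Iio N.toNat).prod (Set.finite_univ (α := K))).subset fun x hx => ⟨hx, trivial⟩
  refine Set.Finite.of_finite_image ((finite_lists_of_bound _ hs t).subset ?_)
    Subtype.val_injective.injOn
  rintro _ ⟨l, hl, rfl⟩
  refine ⟨l.2.1.le, fun x hx => ?_⟩
  have h1 := le_sum_map Prod.fst l.1 x hx
  simp only [Set.mem_ofPred_eq] at hl ⊢
  omega

/-- The smallest part has some colour `x.1` and size `δ x.1 + x.2`; it sets the boundary condition
for the other `t` parts. -/
theorem ladderSum_succ_eq_tsum (hw : ∀ c, OrdGE 0 (w c)) (t : ℕ) (δ : K → ℕ) :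
    Summable (fun x : K × ℕ => w x.1 * qPow ((δ x.1 + x.2 : ℕ) : ℤ) *
      ladderSum D w t fun c => D c x.1 + (δ x.1 + x.2)) ∧
    ladderSum D w (t + 1) δ = ∑' x : K × ℕ, w x.1 * qPow ((δ x.1 + x.2 : ℕ) : ℤ) *
      ladderSum D w t fun c => D c x.1 + (δ x.1 + x.2) := by
  have h1 := (ladderConsEquiv D t δ).hasSum_iff.2 (summable_ladder (D := D) hw (t + 1) δ).hasSum
  have h2 : HasSum (fun x : K × ℕ => w x.1 * qPow ((δ x.1 + x.2 : ℕ) : ℤ) *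
      ladderSum D w t fun c => D c x.1 + (δ x.1 + x.2)) (ladderSum D w (t + 1) δ) := by
    refine HasSum.sigma h1 fun x => ?_
    refine ((summable_ladder hw t _).hasSum.mul_left _).of_eq (fun l => ?_) rfl
    exact ladderWeight_cons w _ _
  exact ⟨h2.summable, h2.tsum_eq.symm⟩

/-- The excess `g` of the smallest part over its bound moves the other `t` parts too, so by the
shift law it contributes a geometric series of ratio `q^{t+1}`. -/
theorem mul_ladderSum_succ_of_shift (hw : ∀ c, OrdGE 0 (w c)) (t : ℕ)
    (hshift : ∀ (δ : K → ℕ) (m : ℕ),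
      ladderSum D w t (fun c => δ c + m) = qPow (t * m) * ladderSum D w t δ) (δ : K → ℕ) :
    (1 - qPow ((t + 1 : ℕ) : ℤ)) * ladderSum D w (t + 1) δ =
      ∑ c : K, w c * qPow ((t + 1 : ℕ) * δ c) * ladderSum D w t fun c' => D c' c := by
  obtain ⟨hs, h1⟩ := ladderSum_succ_eq_tsum (D := D) hw t δ
  obtain ⟨S, hS, hS1⟩ := hasSum_geometric (Nat.succ_pos t)
  have h2 : ∀ c : K, HasSum (fun g : ℕ => w c * qPow ((δ c + g : ℕ) : ℤ) *
      ladderSum D w t fun c' => D c' c + (δ c + g))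
      (w c * qPow ((t + 1 : ℕ) * δ c) * (ladderSum D w t fun c' => D c' c) * S) := by
    intro c
    refine (hS.mul_left _).of_eq (fun g => ?_) rfl
    have h3 : qPow ((δ c + g : ℕ) : ℤ) * qPow (t * (δ c + g : ℕ)) =
        qPow ((t + 1 : ℕ) * δ c) * qPow ((t + 1 : ℕ) * g) := by
      rw [← qPow_add, ← qPow_add]
      congr 1
      push_cast
      ring
    rw [hshift]
    linear_combination (w c * ladderSum D w t fun c' => D c' c) * h3
  rw [h1, (HasSum.prod_of_fintype h2).tsum_eq, ← Finset.sum_mul]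
  linear_combination (∑ c : K, w c * qPow ((t + 1 : ℕ) * δ c) *
    ladderSum D w t fun c' => D c' c) * hS1

/-- The shift law at length `t` gives the recursion at length `t + 1`, where `δ c` occurs only in
`q^{(t+1) δ c}`; this yields the shift law at length `t + 1`. -/
theorem ladderSum_shift (hw : ∀ c, OrdGE 0 (w c)) (t : ℕ) (δ : K → ℕ) (m : ℕ) :
    ladderSum D w t (fun c => δ c + m) = qPow (t * m) * ladderSum D w t δ := by
  induction t generalizing δ m with
  | zero => simp [ladderSum_zero, qPow_zero]
  | succ t ih =>
    refine (isUnit_one_sub_qPow_succ t).mul_left_cancel ?_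
    rw [mul_left_comm, mul_ladderSum_succ_of_shift hw t ih, mul_ladderSum_succ_of_shift hw t ih,
      Finset.mul_sum]
    refine Finset.sum_congr rfl fun c _ => ?_
    push_cast
    rw [mul_add, qPow_add]
    ring

theorem mul_ladderSum_succ (hw : ∀ c, OrdGE 0 (w c)) (t : ℕ) (δ : K → ℕ) :
    (1 - qPow ((t + 1 : ℕ) : ℤ)) * ladderSum D w (t + 1) δ =
      ∑ c : K, w c * qPow ((t + 1 : ℕ) * δ c) * ladderSum D w t fun c' => D c' c :=
  mul_ladderSum_succ_of_shift hw t (ladderSum_shift hw t) δ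

end

/-! ### Rows and generalised Primc partitions -/

/-- The weight `a_i` of a part of the first row. -/
noncomputable def aWeight (n : ℕ) (i : Fin n) : QSeries := aPow i 1

/-- The weight `a_k⁻¹` of a part of the second row. -/
noncomputable def bWeight (n : ℕ) (k : Fin n) : QSeries := aPow k (-1)

theorem ordGE_aWeight (n : ℕ) (i : Fin n) : OrdGE 0 (aWeight n i) := ordGE_aPow _ _

theorem ordGE_bWeight (n : ℕ) (k : Fin n) : OrdGE 0 (bWeight n k) := ordGE_aPow _ _

/-- The minimal differences of the first row. -/
def aDiff (n : ℕ) (i' i : Fin n) : ℕ := if i ≤ i' then 1 else 0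

/-- The minimal differences of the second row. -/
def bDiff (n : ℕ) (k' k : Fin n) : ℕ := if k' ≤ k then 1 else 0

/-- The generating function of the first rows of length `t` whose smallest part is positive if its
colour is one of `a_i, a_{i+1}, …`. -/
noncomputable def rowA (n i t : ℕ) : QSeries :=
  ladderSum (aDiff n) (aWeight n) t fun i' => if i ≤ (i' : ℕ) then 1 else 0

/-- The generating function of the second rows of length `t` whose smallest part is positive if
its colour is one of `b_0, …, b_{k-1}`. -/
noncomputable def rowB (n k t : ℕ) : QSeries :=
  ladderSum (bDiff n) (bWeight n) t fun k' => if (k' : ℕ) < k then 1 else 0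

/-- The family of boundary conditions is closed under removing the smallest part: after a part of
colour `a_{i'}` the rest is subject to the condition of index `i'`. For the second rows, after
`b_{k'}` the new index is `k' + 1`. -/
theorem mul_rowA_succ (n i t : ℕ) :
    (1 - qPow ((t + 1 : ℕ) : ℤ)) * rowA n i (t + 1) =
      ∑ i' ∈ Finset.range n, (if i ≤ i' then qPow ((t + 1 : ℕ) : ℤ) else 1) *
        (aPow i' 1 * rowA n i' t) := by
  rw [rowA, mul_ladderSum_succ (ordGE_aWeight n), ← Fin.sum_univ_eq_sum_range (fun i' =>
    (if i ≤ i' then qPow ((t + 1 : ℕ) : ℤ) else 1) * (aPow i' 1 * rowA n i' t))]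
  refine Finset.sum_congr rfl fun c _ => ?_
  have : (fun c' => aDiff n c' c) = fun i' : Fin n => if (c : ℕ) ≤ i' then 1 else 0 := rfl
  rw [this, ← rowA, aWeight]
  split_ifs with h
  · push_cast
    ring_nf
  · push_cast
    rw [mul_zero, qPow_zero]
    ring

theorem mul_rowB_succ (n k t : ℕ) :
    (1 - qPow ((t + 1 : ℕ) : ℤ)) * rowB n k (t + 1) =
      ∑ k' ∈ Finset.range n, (if k' < k then qPow ((t + 1 : ℕ) : ℤ) else 1) *
        (aPow k' (-1) * rowB n (k' + 1) t) := by
  rw [rowB, mul_ladderSum_succ (ordGE_bWeight n), ← Fin.sum_univ_eq_sum_range (fun k' =>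
    (if k' < k then qPow ((t + 1 : ℕ) : ℤ) else 1) * (aPow k' (-1) * rowB n (k' + 1) t))]
  refine Finset.sum_congr rfl fun c _ => ?_
  have : (fun c' => bDiff n c' c) = fun k' : Fin n => if (k' : ℕ) < c + 1 then 1 else 0 := by
    funext c'
    simp only [bDiff, Fin.le_def, Nat.lt_succ_iff]
  rw [this, ← rowB, bWeight]
  split_ifs with h
  · push_cast
    ring_nf
  · push_cast
    rw [mul_zero, qPow_zero]
    ring

theorem rowA_zero_eq (n t : ℕ) :
    rowA n 0 t = qPow t * ladderSum (aDiff n) (aWeight n) t fun _ => 0 := by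
  have h := ladderSum_shift (D := aDiff n) (ordGE_aWeight n) t (fun _ => 0) 1
  rw [Nat.cast_one, mul_one] at h
  rw [← h]
  simp [rowA]

theorem rowB_zero_eq (n t : ℕ) : rowB n 0 t = ladderSum (bDiff n) (bWeight n) t fun _ => 0 := by
  simp [rowB]

/-- The recursions for neighbouring indices differ in a single summand, whose coefficient `1 -
q^{t+1}` cancels. The periodicity compares rows with all parts positive to unrestricted rows, by a
shift of all parts by 1. -/
theorem rowSystem (n : ℕ) :
    RowSystem n (fun i => aPow i 1) (fun k => aPow k (-1)) (rowA n) (rowB n) where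
  mul_eq_one i := by rw [← aPow_add]; exact aPow_zero i
  r_zero i := ladderSum_zero _
  c_zero k := ladderSum_zero _
  r_succ i t hi := by
    refine (isUnit_one_sub_qPow_succ t).mul_left_cancel ?_
    rw [mul_add, mul_rowA_succ, mul_rowA_succ, ← sub_eq_iff_eq_add', ← Finset.sum_sub_distrib,
      Finset.sum_eq_single i]
    · rw [if_neg (by omega), if_pos le_rfl]
      ring
    · intro b _ hb
      have : i + 1 ≤ b ↔ i ≤ b := by omega
      simp only [this, sub_self]
    · intro h
      exact absurd (Finset.mem_range.2 hi) h
  c_succ k t hk := by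
    refine (isUnit_one_sub_qPow_succ t).mul_left_cancel ?_
    rw [mul_add, mul_rowB_succ, mul_rowB_succ, ← sub_eq_iff_eq_add', ← Finset.sum_sub_distrib,
      Finset.sum_eq_single k]
    · rw [if_neg (by omega), if_pos (by omega)]
      ring
    · intro b _ hb
      have : b < k + 1 ↔ b < k := by omega
      simp only [this, sub_self]
    · intro h
      exact absurd (Finset.mem_range.2 hk) h
  r_periodic t := by
    rw [rowA_zero_eq, rowA]
    congr 2
    funext i
    rw [if_neg (by omega)]
  c_periodic t := by
    have h := ladderSum_shift (D := bDiff n) (ordGE_bWeight n) t (fun _ => 0) 1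
    rw [Nat.cast_one, mul_one] at h
    rw [rowB_zero_eq, ← h, rowB]
    congr 1
    funext k
    rw [if_pos k.isLt]

/-- The minimal differences `Δ` of generalised Primc partitions. -/
def primcDiff (n : ℕ) (c c' : Fin n × Fin n) : ℕ := (minDiff c.1 c.2 c'.1 c'.2).toNat

/-- The weight `a_i a_k⁻¹` of a part of colour `a_i b_k`. -/
noncomputable def primcWeight (n : ℕ) (c : Fin n × Fin n) : QSeries := aPow c.1 1 * aPow c.2 (-1)

theorem ordGE_primcWeight (n : ℕ) (c : Fin n × Fin n) : OrdGE 0 (primcWeight n c) :=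
  ((ordGE_aPow _ _).mul (ordGE_aPow _ _)).mono (by simp)

/-- The minimal difference splits into two 0-1 conditions. The correction `χ(k' = i = k)` turns `k'
≤ k` into `k' < k` exactly when `i = k`, hence the threshold `k` or `k + 1`; these are the weights
in `RowSystem.sum_hMixed`. -/
theorem qPow_mul_primcDiff (n t i k : ℕ) (c c' : Fin n × Fin n) (hi : i = c'.1) (hk : k = c'.2) :
    qPow ((t + 1 : ℕ) * primcDiff n c c') =
      (if (c.2 : ℕ) < (if i = k then k else k + 1) then qPow ((t + 1 : ℕ) : ℤ) else 1) *
      (if i ≤ (c.1 : ℕ) ∧ ¬ ((c.1 : ℕ) = c.2 ∧ (c.2 : ℕ) = i) then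
        qPow ((t + 1 : ℕ) : ℤ) else 1) := by
  have h : primcDiff n c c' = (if (c.2 : ℕ) < (if i = k then k else k + 1) then 1 else 0) +
      (if i ≤ (c.1 : ℕ) ∧ ¬ ((c.1 : ℕ) = c.2 ∧ (c.2 : ℕ) = i) then 1 else 0) := by
    rw [primcDiff, minDiff, ← hi, ← hk]
    generalize (c.1 : ℕ) = i'
    generalize (c.2 : ℕ) = k'
    split_ifs <;> first | rfl | omega
  rw [h]
  split_ifs <;> simp [qPow_zero, ← qPow_add, mul_two]

/-- Both sides equal 1 at length 0 and satisfy the same recursion in `t`. -/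
theorem ladderSum_primc_eq_hMixed (n t : ℕ) (c' : Fin n × Fin n) :
    ladderSum (primcDiff n) (primcWeight n) t (fun c => primcDiff n c c') =
      hMixed (rowA n) (rowB n) t c'.1 (if (c'.1 : ℕ) = c'.2 then (c'.2 : ℕ) else c'.2 + 1) := by
  have h := rowSystem n
  induction t generalizing c' with
  | zero => simp [ladderSum_zero, hMixed, hPlus, hMinus, qFall_zero, h.r_zero, h.c_zero, qPow_zero]
  | succ t ih =>
    refine (isUnit_one_sub_qPow_succ t).mul_left_cancel ?_
    rw [mul_ladderSum_succ (ordGE_primcWeight n), ← h.sum_hMixed t c'.1.isLt (by split_ifs <;> omega),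
      Fintype.sum_prod_type_right, ← Fin.sum_univ_eq_sum_range (fun k' : ℕ => (if k' < _ then _ else _) * _)]
    refine Finset.sum_congr rfl fun k' _ => ?_
    rw [Finset.mul_sum, ← Fin.sum_univ_eq_sum_range (fun i' : ℕ => _ * (_ * _))]
    refine Finset.sum_congr rfl fun i' _ => ?_
    rw [ih, qPow_mul_primcDiff n t _ _ _ c' rfl rfl, primcWeight]
    simp only
    ring

/-- The boundary colour `a_0 b_0` demands size at least 1 from every colour except `a_0 b_0`, which
may have size 0. Ladders with this boundary are thus Primc partitions with at most `t` positive
parts, padded by zeros of weight 1. -/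
theorem ladderSum_primc_one (N t : ℕ) :
    ∑ v ∈ Finset.range (t + 1), ladderSum (primcDiff (N + 1)) (primcWeight (N + 1)) v (fun _ => 1) =
      hPlus (rowA (N + 1)) (rowB (N + 1)) t 0 0 := by
  have h := rowSystem (N + 1)
  have h00 : ∀ t, ladderSum (primcDiff (N + 1)) (primcWeight (N + 1)) t
      (fun c => primcDiff (N + 1) c (0, 0)) = hPlus (rowA (N + 1)) (rowB (N + 1)) t 0 0 := fun t => by
    rw [ladderSum_primc_eq_hMixed]
    simp [hMixed]
  induction t with
  | zero => simp [ladderSum_zero, hPlus, qFall_zero, h.r_zero, h.c_zero]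
  | succ t ih =>
    rw [Finset.sum_range_succ, ih, ← eq_sub_iff_add_eq', ← h00 (t + 1), ← h00 t]
    refine (isUnit_one_sub_qPow_succ t).mul_left_cancel ?_
    -- The recursions for the two boundary conditions differ only in the summand of the colour `a_0
    -- b_0`.
    have hdiff : ∑ c, primcWeight (N + 1) c * qPow ((t + 1 : ℕ) * (1 : ℕ)) *
          (ladderSum (primcDiff (N + 1)) (primcWeight (N + 1)) t fun c' => primcDiff (N + 1) c' c) -
        ∑ c, primcWeight (N + 1) c * qPow ((t + 1 : ℕ) * primcDiff (N + 1) c (0, 0)) *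
          (ladderSum (primcDiff (N + 1)) (primcWeight (N + 1)) t fun c' => primcDiff (N + 1) c' c) =
        (qPow ((t + 1 : ℕ) : ℤ) - 1) * ladderSum (primcDiff (N + 1)) (primcWeight (N + 1)) t
          fun c' => primcDiff (N + 1) c' (0, 0) := by
      rw [← Finset.sum_sub_distrib, Finset.sum_eq_single (0, 0)]
      · have h1 : primcDiff (N + 1) (0, 0) (0, 0) = 0 := by simp [primcDiff, minDiff]
        have h2 : primcWeight (N + 1) (0, 0) = 1 := h.mul_eq_one 0
        rw [h1, h2, Nat.cast_zero, mul_zero, qPow_zero, Nat.cast_one, mul_one]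
        ring
      · rintro ⟨i', k'⟩ - hc
        have h1 : primcDiff (N + 1) (i', k') (0, 0) = 1 := by
          have hc' : ¬ ((i' : ℕ) = 0 ∧ (k' : ℕ) = 0) := fun h => hc (by ext <;> simp [h])
          change (minDiff i' k' 0 0).toNat = 1
          rw [minDiff]
          split_ifs <;> first | rfl | omega
        rw [h1, sub_self]
      · intro h1
        exact absurd (Finset.mem_univ _) h1
    rw [mul_sub, mul_ladderSum_succ (ordGE_primcWeight _), mul_ladderSum_succ (ordGE_primcWeight _)]
    linear_combination hdiff

/-! ### Explicit formulas for the rows -/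

theorem coeff_prod_univ {R : Type*} [CommRing R] {n : ℕ} (f : Fin n → PowerSeries R) (t : ℕ) :
    PowerSeries.coeff t (∏ j, f j) =
      ∑ u ∈ Finset.piAntidiag (Finset.univ : Finset (Fin n)) t, ∏ j, PowerSeries.coeff (u j) (f j) := by
  rw [PowerSeries.coeff_prod]
  refine Finset.sum_nbij' (fun l => ⇑l) (fun u => Finsupp.equivFunOnFinite.symm u) ?_ ?_ ?_ ?_ ?_
  · intro l hl
    simpa using (Finset.mem_finsuppAntidiag.1 hl).1
  · intro u hu
    simpa using (Finset.mem_piAntidiag.1 hu).1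
  · intro l _
    simp
  · intro u _
    simp
  · intro l _
    rfl

/-- A power series with `P(x) = M(x) P(qx)`, where `M(0) = 1`, is determined by `P(0)`. -/
theorem eq_of_functional_equation {R : Type*} [CommRing R] {q : R}
    (hq : ∀ t, IsUnit (1 - q ^ (t + 1))) {M P P' : PowerSeries R}
    (hM : PowerSeries.coeff 0 M = 1) (hP : P = M * PowerSeries.rescale q P)
    (hP' : P' = M * PowerSeries.rescale q P') (h0 : PowerSeries.coeff 0 P = PowerSeries.coeff 0 P') :
    P = P' := by
  have hD : P - P' = M * PowerSeries.rescale q (P - P') := by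
    rw [map_sub, mul_sub, ← hP, ← hP']
  suffices h : ∀ t, PowerSeries.coeff t (P - P') = 0 by
    refine PowerSeries.ext fun t => ?_
    have := h t
    rwa [map_sub, sub_eq_zero] at this
  intro t
  induction t using Nat.strong_induction_on with
  | _ t ih =>
    rcases t with _ | t
    · rw [map_sub, h0, sub_self]
    · have h1 := congrArg (PowerSeries.coeff (t + 1)) hD
      rw [PowerSeries.coeff_mul, Finset.sum_eq_single (0, t + 1), hM, PowerSeries.coeff_rescale,
        one_mul] at h1
      · refine (hq t).mul_left_cancel ?_
        linear_combination h1
      · rintro ⟨a, b⟩ hab hne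
        rw [Finset.HasAntidiagonal.mem_antidiagonal] at hab
        simp only at hab
        have hb : b < t + 1 := by
          rcases Nat.eq_zero_or_pos a with rfl | ha
          · exact absurd (by rw [← hab, zero_add]) hne
          · omega
        simp only
        rw [PowerSeries.coeff_rescale, ih b hb, mul_zero, mul_zero]
      · intro h
        exact absurd (Finset.HasAntidiagonal.mem_antidiagonal.2 (zero_add _)) h

/-- `∑ q^{u(u-1)/2} x^u / (q)_u`. -/
noncomputable def eulerSeries : PowerSeries QSeries := PowerSeries.mk (eulerCoeff 1)

theorem rescale_eulerSeries (a : QSeries) :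
    PowerSeries.rescale a eulerSeries = (1 + PowerSeries.C a * PowerSeries.X) *
      PowerSeries.rescale (qPow 1) (PowerSeries.rescale a eulerSeries) := by
  refine PowerSeries.ext fun t => ?_
  rw [PowerSeries.rescale_rescale, add_mul, one_mul, map_add, mul_assoc, PowerSeries.coeff_C_mul]
  rcases t with _ | t
  · rw [PowerSeries.coeff_zero_X_mul]
    simp [PowerSeries.coeff_rescale]
  · rw [PowerSeries.coeff_succ_X_mul, PowerSeries.coeff_rescale, PowerSeries.coeff_rescale,
      PowerSeries.coeff_rescale, eulerSeries, PowerSeries.coeff_mk, PowerSeries.coeff_mk, mul_pow,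
      mul_pow, ← qPow_mul, ← qPow_mul]
    have h := eulerCoeff_succ one_pos t
    push_cast at h ⊢
    linear_combination a ^ (t + 1) * h

theorem isUnit_one_sub_qPow_one_pow (t : ℕ) : IsUnit (1 - qPow 1 ^ (t + 1)) := by
  rw [← qPow_mul, one_mul]
  exact isUnit_one_sub_qPow_succ t

/-- The solution of the functional equation of the rows. -/
theorem eq_prod_eulerSeries {n : ℕ} (A : Fin n → QSeries) {P : PowerSeries QSeries}
    (h0 : PowerSeries.coeff 0 P = 1)
    (hP : P = (∏ j, (1 + PowerSeries.C (A j) * PowerSeries.X)) * PowerSeries.rescale (qPow 1) P) :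
    P = ∏ j, PowerSeries.rescale (A j) eulerSeries := by
  refine eq_of_functional_equation isUnit_one_sub_qPow_one_pow ?_ hP ?_ ?_
  · simp [PowerSeries.coeff_zero_eq_constantCoeff]
  · rw [map_prod, ← Finset.prod_mul_distrib]
    exact Finset.prod_congr rfl fun j _ => rescale_eulerSeries (A j)
  · rw [h0, PowerSeries.coeff_zero_eq_constantCoeff, map_prod]
    symm
    refine Finset.prod_eq_one fun j _ => ?_
    rw [← PowerSeries.coeff_zero_eq_constantCoeff_apply, PowerSeries.coeff_rescale, eulerSeries,
      PowerSeries.coeff_mk, eulerCoeff_zero one_pos, pow_zero, one_mul]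

namespace RowSystem

variable {n : ℕ} {A B : ℕ → QSeries} {r c : ℕ → ℕ → QSeries}

/-- Each step from `r i` to `r (i + 1)` multiplies the series by `1 + A_i x`, and the periodicity
identifies `r 0` with `r n` at `qx`. The resulting functional equation determines the series. -/
theorem mk_r_last (h : RowSystem n A B r c) :
    PowerSeries.mk (r n) = ∏ j : Fin n, PowerSeries.rescale (A j) eulerSeries := by
  have hstep : ∀ i ≤ n, PowerSeries.mk (r i) =
      (∏ j ∈ Finset.range i, (1 + PowerSeries.C (A j) * PowerSeries.X)) * PowerSeries.mk (r 0) := by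
    intro i hi
    induction i with
    | zero => simp
    | succ i ih =>
      rw [Finset.prod_range_succ, mul_right_comm, ← ih (by omega)]
      refine PowerSeries.ext fun t => ?_
      rw [mul_add, mul_one, map_add, mul_left_comm, PowerSeries.coeff_C_mul]
      rcases t with _ | t
      · rw [PowerSeries.coeff_zero_mul_X]
        simp [h.r_zero]
      · rw [PowerSeries.coeff_succ_mul_X, PowerSeries.coeff_mk, PowerSeries.coeff_mk,
          PowerSeries.coeff_mk, h.r_succ i t (by omega)]
  refine eq_prod_eulerSeries (fun j => A j) ?_ ?_
  · rw [PowerSeries.coeff_mk, h.r_zero]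
  · rw [Fin.prod_univ_eq_prod_range fun j => (1 + PowerSeries.C (A j) * PowerSeries.X)]
    refine (hstep n le_rfl).trans ?_
    congr 1
    refine PowerSeries.ext fun t => ?_
    rw [PowerSeries.coeff_rescale, PowerSeries.coeff_mk, PowerSeries.coeff_mk, h.r_periodic,
      ← qPow_mul, one_mul]

theorem mk_c_zero (h : RowSystem n A B r c) :
    PowerSeries.mk (c 0) = ∏ j : Fin n, PowerSeries.rescale (B j) eulerSeries := by
  have hstep : ∀ i ≤ n, PowerSeries.mk (c 0) =
      (∏ j ∈ Finset.range i, (1 + PowerSeries.C (B j) * PowerSeries.X)) * PowerSeries.mk (c i) := by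
    intro i hi
    induction i with
    | zero => simp
    | succ i ih =>
      rw [Finset.prod_range_succ, ih (by omega), mul_assoc]
      congr 1
      refine PowerSeries.ext fun t => ?_
      rw [add_mul, one_mul, map_add, mul_assoc, PowerSeries.coeff_C_mul]
      rcases t with _ | t
      · rw [PowerSeries.coeff_zero_X_mul]
        simp [h.c_zero]
      · rw [PowerSeries.coeff_succ_X_mul, PowerSeries.coeff_mk, PowerSeries.coeff_mk,
          PowerSeries.coeff_mk, h.c_succ i t (by omega)]
  refine eq_prod_eulerSeries (fun j => B j) ?_ ?_
  · rw [PowerSeries.coeff_mk, h.c_zero]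
  · rw [Fin.prod_univ_eq_prod_range fun j => (1 + PowerSeries.C (B j) * PowerSeries.X)]
    refine (hstep n le_rfl).trans ?_
    congr 1
    refine PowerSeries.ext fun t => ?_
    rw [PowerSeries.coeff_rescale, PowerSeries.coeff_mk, PowerSeries.coeff_mk, h.c_periodic,
      ← qPow_mul, one_mul]

theorem r_zero_eq_sum (h : RowSystem n A B r c) (t : ℕ) :
    r 0 t = ∑ u ∈ Finset.piAntidiag (Finset.univ : Finset (Fin n)) t,
      ∏ j : Fin n, ((qPow 1 * A j) ^ u j * eulerCoeff 1 (u j)) := by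
  have h1 : PowerSeries.mk (r 0) =
      ∏ j : Fin n, PowerSeries.rescale (qPow 1 * A j) eulerSeries := by
    have h2 : PowerSeries.mk (r 0) = PowerSeries.rescale (qPow 1) (PowerSeries.mk (r n)) := by
      refine PowerSeries.ext fun t => ?_
      rw [PowerSeries.coeff_rescale, PowerSeries.coeff_mk, PowerSeries.coeff_mk, h.r_periodic,
        ← qPow_mul, one_mul]
    rw [h2, h.mk_r_last, map_prod]
    refine Finset.prod_congr rfl fun j _ => ?_
    rw [PowerSeries.rescale_rescale, mul_comm]
  rw [← PowerSeries.coeff_mk t (r 0), h1, coeff_prod_univ]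
  simp only [PowerSeries.coeff_rescale, eulerSeries, PowerSeries.coeff_mk]

theorem c_zero_eq_sum (h : RowSystem n A B r c) (t : ℕ) :
    c 0 t = ∑ u ∈ Finset.piAntidiag (Finset.univ : Finset (Fin n)) t,
      ∏ j : Fin n, (B j ^ u j * eulerCoeff 1 (u j)) := by
  rw [← PowerSeries.coeff_mk t (c 0), h.mk_c_zero, coeff_prod_univ]
  simp only [PowerSeries.coeff_rescale, eulerSeries, PowerSeries.coeff_mk]

end RowSystem

/-! ### The generating function of Frobenius partitions as a series over the lattice -/

/-- The lengths of the one-coloured pieces of two rows of the same length. -/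
abbrev RowPairs (n : ℕ) : Type := {x : Fin n → ℕ × ℕ // ∑ j, (x j).1 = ∑ j, (x j).2}

/-- `a_j^p q^{p(p+1)/2}`. -/
noncomputable def thetaTerm (j : ℕ) (p : ℤ) : QSeries := aPow j p * qPow (p * (p + 1) / 2)

/-- The contribution of the colours `a_j` and `b_j`, which appear `x.1` and `x.2` times. -/
noncomputable def pairTerm (j : ℕ) (x : ℕ × ℕ) : QSeries :=
  (qPow 1 * aPow j 1) ^ x.1 * eulerCoeff 1 x.1 * (aPow j (-1) ^ x.2 * eulerCoeff 1 x.2)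

theorem aPow_pow (j : ℕ) (k : ℤ) (u : ℕ) : aPow j k ^ u = aPow j (u * k) := by
  rw [← prod_aPow_const j u k, Finset.prod_const, Finset.card_range]

theorem two_mul_half (p : ℤ) : 2 * (p * (p + 1) / 2) = p * (p + 1) :=
  Int.mul_ediv_cancel' (Int.even_mul_succ_self p).two_dvd

/-- With `p = u - v`, the exponents agree by `u(u+1)/2 + v(v-1)/2 = p(p+1)/2 + uv`. The second
factor is the summand of Cauchy's identity. -/
theorem pairTerm_eq (j : ℕ) (x : ℕ × ℕ) :
    pairTerm j x = thetaTerm j ((x.1 : ℤ) - x.2) *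
      (qPow ((1 : ℕ) * (x.1 * x.2)) * qInv 1 x.1 * qInv 1 x.2) := by
  obtain ⟨u, v⟩ := x
  have h1 : qPow (1 * u) * qPow ((1 : ℕ) * (u.choose 2 : ℕ)) * qPow ((1 : ℕ) * (v.choose 2 : ℕ)) =
      qPow (((u : ℤ) - v) * (u - v + 1) / 2) * qPow ((1 : ℕ) * (u * v)) := by
    simp only [← qPow_add]
    congr 1
    have h2 := two_mul_half ((u : ℤ) - v)
    have h3 := two_mul_choose_two u
    have h4 := two_mul_choose_two v
    push_cast
    linarith
  have h2 : aPow j ((u : ℤ) - v) = aPow j (u * 1) * aPow j (v * -1) := by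
    rw [← aPow_add]
    ring_nf
  simp only [pairTerm, thetaTerm, mul_pow, aPow_pow, ← qPow_mul, eulerCoeff, h2]
  linear_combination (aPow j (u * 1) * aPow j (v * -1) * qInv 1 u * qInv 1 v) * h1

theorem summable_pairTerm (j : ℕ) : Summable (pairTerm j) :=
  (hasSum_mul_prod (hasSum_euler one_pos (qPow 1 * aPow j 1))
    (hasSum_euler one_pos (aPow j (-1)))).summable

/-- Sorting pairs of rows by their length. -/
def rowPairsLengthEquiv (n : ℕ) :
    (Σ t : ℕ, ↥(Finset.piAntidiag (Finset.univ : Finset (Fin n)) t ×ˢ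
      Finset.piAntidiag (Finset.univ : Finset (Fin n)) t)) ≃ RowPairs n where
  toFun y := ⟨fun j => (y.2.1.1 j, y.2.1.2 j), by
    have h := Finset.mem_product.1 y.2.2
    rw [(Finset.mem_piAntidiag.1 h.1).1, (Finset.mem_piAntidiag.1 h.2).1]⟩
  invFun x := ⟨∑ j, (x.1 j).1, (fun j => (x.1 j).1, fun j => (x.1 j).2), by
    rw [Finset.mem_product, Finset.mem_piAntidiag, Finset.mem_piAntidiag]
    exact ⟨⟨rfl, fun _ _ => Finset.mem_univ _⟩, x.2.symm, fun _ _ => Finset.mem_univ _⟩⟩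
  left_inv := by
    rintro ⟨t, ⟨u, v⟩, h⟩
    obtain rfl := (Finset.mem_piAntidiag.1 (Finset.mem_product.1 h).1).1
    rfl
  right_inv x := rfl

/-- Sorting pairs of rows by the excess of each `a_j` over `b_j`. -/
def rowPairsExcessEquiv (n : ℕ) : {p : Fin n → ℤ // ∑ j, p j = 0} × (Fin n → ℕ) ≃ RowPairs n where
  toFun y := ⟨fun j => subMinEquiv (y.1.1 j, y.2 j), by
    have h : ∀ j, ((subMinEquiv (y.1.1 j, y.2 j)).1 : ℤ) =
        (subMinEquiv (y.1.1 j, y.2 j)).2 + y.1.1 j := fun j => by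
      simp only [subMinEquiv, Equiv.coe_fn_mk]
      omega
    zify
    rw [Finset.sum_congr rfl fun j _ => h j, Finset.sum_add_distrib, y.1.2, add_zero]⟩
  invFun x := (⟨fun j => (subMinEquiv.symm (x.1 j)).1, by
    have h : ∀ j, (subMinEquiv.symm (x.1 j)).1 = ((x.1 j).1 : ℤ) - (x.1 j).2 := fun j => rfl
    rw [Finset.sum_congr rfl fun j _ => h j, Finset.sum_sub_distrib, sub_eq_zero]
    exact_mod_cast x.2⟩, fun j => (subMinEquiv.symm (x.1 j)).2)
  left_inv y := by
    ext j
    · simp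
    · simp
  right_inv x := by
    ext j
    · simp
    · simp

theorem summable_rowPairs (n : ℕ) :
    Summable fun x : RowPairs n => ∏ j : Fin n, pairTerm j (x.1 j) :=
  (hasSum_pi_prod n (fun j => pairTerm j) fun j => summable_pairTerm j).summable.of_ordGE
    Subtype.val Subtype.val_injective fun _ _ h => h

theorem RowSystem.hasSum_rows {n : ℕ} {r c : ℕ → ℕ → QSeries}
    (h : RowSystem n (fun i => aPow i 1) (fun k => aPow k (-1)) r c) :
    HasSum (fun t => r 0 t * c 0 t) (∑' x : RowPairs n, ∏ j : Fin n, pairTerm j (x.1 j)) := by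
  have h1 := (rowPairsLengthEquiv n).hasSum_iff.2 (summable_rowPairs n).hasSum
  refine HasSum.sigma h1 fun t => ?_
  have h2 := Finset.hasSum (Finset.piAntidiag (Finset.univ : Finset (Fin n)) t ×ˢ
      Finset.piAntidiag (Finset.univ : Finset (Fin n)) t) fun y : (Fin n → ℕ) × (Fin n → ℕ) =>
        (∏ j : Fin n, ((qPow 1 * aPow j 1) ^ y.1 j * eulerCoeff 1 (y.1 j))) *
          ∏ j : Fin n, (aPow j (-1) ^ y.2 j * eulerCoeff 1 (y.2 j))
  refine h2.of_eq (fun y => ?_) ?_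
  · rw [Function.comp_apply, Function.comp_apply, ← Finset.prod_mul_distrib]
    rfl
  · rw [h.r_zero_eq_sum, h.c_zero_eq_sum, Finset.sum_mul_sum, Finset.sum_product]

/-- Equality of the row lengths only constrains the excesses `p_j`. For fixed `p` the minima of the
pairs are free and independent, and Cauchy's identity applies to each of the `n` colours. -/
theorem hasSum_excess (n : ℕ) :
    HasSum (fun p : {p : Fin n → ℤ // ∑ j, p j = 0} =>
      qInvInf 1 ^ n * ∏ j : Fin n, thetaTerm j (p.1 j))
      (∑' x : RowPairs n, ∏ j : Fin n, pairTerm j (x.1 j)) := by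
  have h1 := (rowPairsExcessEquiv n).hasSum_iff.2 (summable_rowPairs n).hasSum
  refine HasSum.prod_fiberwise h1 fun p => ?_
  have h2 : ∀ j : Fin n, HasSum (fun k : ℕ => pairTerm j (subMinEquiv (p.1 j, k)))
      (thetaTerm j (p.1 j) * qInvInf 1) := fun j => by
    refine ((hasSum_fibre one_pos (p.1 j)).mul_left (thetaTerm j (p.1 j))).of_eq (fun k => ?_) rfl
    rw [pairTerm_eq]
    congr 2
    exact congrArg Prod.fst (subMinEquiv.left_inv (p.1 j, k))
  refine (hasSum_pi_prod n (fun j k => pairTerm j (subMinEquiv (p.1 j, k)))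
    fun j => (h2 j).summable).of_eq (fun k => rfl) ?_
  rw [Finset.prod_congr rfl fun j _ => (h2 j).tsum_eq, Finset.prod_mul_distrib, Finset.prod_const,
    Finset.card_univ, Fintype.card_fin, mul_comm]

/-- `p_0 = -s_1` and `p_i = s_i - s_{i+1}`. -/
def excessEquiv (N : ℕ) : (Fin N → ℤ) ≃ {p : Fin (N + 1) → ℤ // ∑ j, p j = 0} where
  toFun s := ⟨fun j => toSeq s j - toSeq s (j + 1), by
    rw [Fin.sum_univ_eq_sum_range fun j => toSeq s j - toSeq s (j + 1), Finset.sum_range_sub',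
      toSeq_of_lt s (Nat.lt_succ_self N)]
    simp [toSeq]⟩
  invFun p j := -∑ l ∈ Finset.range ((j : ℕ) + 1), toSeq p.1 (l + 1)
  left_inv s := by
    funext j
    have h : ∀ l ∈ Finset.range ((j : ℕ) + 1),
        toSeq (fun j : Fin (N + 1) => toSeq s j - toSeq s (j + 1)) (l + 1) =
          toSeq s l - toSeq s (l + 1) := fun l hl =>
      toSeq_succ (fun j : Fin (N + 1) => toSeq s j - toSeq s (j + 1))
        ⟨l, by have := Finset.mem_range.1 hl; omega⟩
    change -∑ l ∈ Finset.range ((j : ℕ) + 1),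
      toSeq (fun j : Fin (N + 1) => toSeq s j - toSeq s (j + 1)) (l + 1) = s j
    rw [Finset.sum_congr rfl h, Finset.sum_range_sub', toSeq_succ]
    simp [toSeq]
  right_inv p := by
    have h : ∀ i ≤ N + 1, toSeq (fun j : Fin N =>
        -∑ l ∈ Finset.range ((j : ℕ) + 1), toSeq p.1 (l + 1)) i =
          -∑ l ∈ Finset.range i, toSeq p.1 (l + 1) := by
      intro i hi
      rcases Nat.eq_zero_or_pos i with rfl | hpos
      · simp [toSeq]
      obtain ⟨i, rfl⟩ := Nat.exists_eq_add_of_le' hpos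
      by_cases hN : i < N
      · exact toSeq_succ _ (⟨i, hN⟩ : Fin N)
      -- At index `N + 1` the default value 0 of `toSeq` is the right one because the `p_j` sum to
      -- 0.
      · obtain rfl : i = N := by omega
        rw [toSeq_of_lt _ (Nat.lt_succ_self i), ← Fin.sum_univ_eq_sum_range
          fun l => toSeq p.1 (l + 1), Finset.sum_congr rfl fun l _ => toSeq_succ p.1 l, p.2, neg_zero]
    refine Subtype.ext (funext fun j => ?_)
    simp only
    rw [h j (by omega), h (j + 1) (by omega), Finset.sum_range_succ, toSeq_succ]
    ring

/-- With `T(x) = x(x+1)/2`, the induction rests on `T(a - b) + T(a - 1) = a(a - b) + T(b - 1)`. The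
extra factor disappears when the last entry is 0. -/
theorem prod_thetaTerm (S : ℕ → ℤ) (hS : S 0 = 0) (N : ℕ) :
    ∏ j ∈ Finset.range (N + 1), thetaTerm j (S j - S (j + 1)) =
      aPow 0 (-S 1) * (∏ i ∈ Finset.Ico 1 (N + 1), latticeFactor S i) *
        qPow ((S (N + 1) - 1) * (S (N + 1) - 1 + 1) / 2) := by
  induction N with
  | zero =>
    simp only [zero_add, Finset.prod_range_one, Finset.Ico_self, Finset.prod_empty, mul_one,
      thetaTerm, hS, zero_sub]
    congr 3
    ring
  | succ N ih =>
    have hq : qPow ((S (N + 1) - 1) * (S (N + 1) - 1 + 1) / 2) *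
        qPow ((S (N + 1) - S (N + 1 + 1)) * (S (N + 1) - S (N + 1 + 1) + 1) / 2) =
        qPow (S (N + 1) * (S (N + 1) - S (N + 1 + 1))) *
          qPow ((S (N + 1 + 1) - 1) * (S (N + 1 + 1) - 1 + 1) / 2) := by
      rw [← qPow_add, ← qPow_add]
      congr 1
      have h1 := two_mul_half (S (N + 1) - 1)
      have h2 := two_mul_half (S (N + 1) - S (N + 1 + 1))
      have h3 := two_mul_half (S (N + 1 + 1) - 1)
      linarith
    rw [Finset.prod_range_succ, ih, Finset.prod_Ico_succ_top (Nat.succ_le_succ (Nat.zero_le N)),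
      thetaTerm, latticeFactor]
    linear_combination (aPow 0 (-S 1) * (∏ i ∈ Finset.Ico 1 (N + 1), latticeFactor S i) *
      aPow (N + 1) (S (N + 1) - S (N + 1 + 1))) * hq

theorem latticeTerm_eq_prod_thetaTerm (N : ℕ) (s : Fin N → ℤ) :
    latticeTerm (N + 1) s = ∏ j : Fin (N + 1), thetaTerm j ((excessEquiv N s).1 j) := by
  have h := prod_thetaTerm (toSeq s) (by simp [toSeq]) N
  rw [toSeq_of_lt s (Nat.lt_succ_self N), ← Fin.prod_univ_eq_prod_range fun j =>
    thetaTerm j (toSeq s j - toSeq s (j + 1))] at h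
  norm_num [qPow_zero] at h
  exact h.symm

/-- The generating function of Frobenius partitions as a series over the lattice. -/
theorem RowSystem.tsum_rows {N : ℕ} {r c : ℕ → ℕ → QSeries}
    (h : RowSystem (N + 1) (fun i => aPow i 1) (fun k => aPow k (-1)) r c) :
    ∑' t, r 0 t * c 0 t =
      qInvInf 1 ^ (N + 1) * ∑' s : Fin N → ℤ, latticeTerm (N + 1) s := by
  have h1 := (excessEquiv N).hasSum_iff.2 (hasSum_excess (N + 1))
  have h2 : HasSum (fun s : Fin N → ℤ => qInvInf 1 ^ (N + 1) * latticeTerm (N + 1) s) _ :=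
    h1.of_eq (fun s => by rw [latticeTerm_eq_prod_thetaTerm]; rfl) rfl
  have h3 : Summable (latticeTerm (N + 1) : (Fin N → ℤ) → QSeries) := (hasSum_latticeTerm N).summable
  rw [h.hasSum_rows.tsum_eq, ← h2.tsum_eq]
  exact h3.tsum_mul_left _

/-! ### Counting coloured partitions and Frobenius partitions -/

theorem hasSum_ncard_fibre {α X : Type*} (stat : α → X) (W : X → QSeries)
    (hs : Summable fun l => W (stat l)) (hfin : ∀ x, {l | stat l = x}.Finite) :
    HasSum (fun x => ({l | stat l = x}.ncard : QSeries) * W x) (∑' l, W (stat l)) := by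
  have h1 := (Equiv.sigmaFiberEquiv stat).hasSum_iff.2 hs.hasSum
  refine HasSum.sigma h1 fun x => ?_
  have : Fintype {l // stat l = x} := (hfin x).fintype
  refine (hasSum_fintype fun _ : {l // stat l = x} => W x).of_eq (fun l => ?_) ?_
  · exact congrArg W l.2
  · rw [Finset.sum_const, nsmul_eq_mul, Finset.card_univ, ← Nat.card_eq_fintype_card]
    rfl

theorem prod_map_qPow {α : Type*} (s : α → ℕ) (l : List α) :
    (l.map fun x => qPow (s x)).prod = qPow ((l.map s).sum : ℕ) := by
  induction l with
  | nil => simp [qPow_zero]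
  | cons x l ih => simp [ih, qPow_add]

theorem prod_map_aPow {α : Type*} {n : ℕ} (g : α → ℕ) (k : ℤ) (l : List α) (hl : ∀ x ∈ l, g x < n) :
    (l.map fun x => aPow (g x) k).prod =
      ∏ i : Fin n, aPow i (k * (l.countP fun x => g x = (i : ℕ) : ℕ)) := by
  induction l with
  | nil => simp [aPow_zero]
  | cons x l ih =>
    rw [List.map_cons, List.prod_cons, ih fun y hy => hl y (by simp [hy])]
    have h : ∏ i : Fin n, aPow i (if g x = (i : ℕ) then k else 0) = aPow (g x) k := by
      rw [Finset.prod_eq_single ⟨g x, hl x (by simp)⟩]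
      · rw [if_pos rfl]
      · intro i _ hi
        rw [if_neg fun h => hi (Fin.ext h.symm), aPow_zero]
      · intro h
        exact absurd (Finset.mem_univ _) h
    rw [← h, ← Finset.prod_mul_distrib]
    refine Finset.prod_congr rfl fun i _ => ?_
    rw [← aPow_add, List.countP_cons]
    congr 1
    split_ifs with h1 h2 h2 <;> simp_all
    ring

theorem pos_of_isLadder {K : Type*} {D : K → K → ℕ} {δ : K → ℕ} {l : List (ℕ × K)}
    (hδ : ∀ c, 0 < δ c) (h : IsLadder D δ l) : ∀ x ∈ l, 0 < x.1 := by
  induction l generalizing δ with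
  | nil => simp
  | cons x l ih =>
    have h1 := isLadder_cons.1 h
    have h2 : 0 < x.1 := lt_of_lt_of_le (hδ _) h1.1
    intro y hy
    rcases List.mem_cons.1 hy with rfl | hy
    · exact h2
    · exact ih (fun c => Nat.add_pos_right _ h2) h1.2 y hy

theorem eq_reverse_map_of_forall {α β : Type*} (f : α → β) (L : List β)
    (hL : ∀ x ∈ L, x ∈ Set.range f) : ∃ l : List α, (l.map f).reverse = L := by
  have : L.reverse ∈ Set.range (List.map f) := by
    rw [Set.range_list_map]
    intro x hx
    exact hL x (List.mem_reverse.1 hx)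
  obtain ⟨l, hl⟩ := this
  exact ⟨l, by rw [hl, List.reverse_reverse]⟩

/-! #### Generalised Primc partitions -/

/-- A part, with its colour given by two indices less than `n`. -/
def toColouredPart (n : ℕ) (x : ℕ × (Fin n × Fin n)) : ColouredPart := ⟨x.1, x.2.1, x.2.2⟩

theorem toColouredPart_injective (n : ℕ) : Function.Injective (toColouredPart n) := by
  rintro ⟨a, b, c⟩ ⟨a', b', c'⟩ h
  simp only [toColouredPart, ColouredPart.mk.injEq] at h
  ext
  · exact h.1
  · exact h.2.1
  · exact h.2.2

/-- Ladders list the parts in increasing order, hence the reversal. Truncating the minimal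
difference at 0 absorbs the condition that the parts do not increase, and positivity is needed only
for the smallest part. -/
theorem isPrimcPartition_iff (n : ℕ) (l : List (ℕ × (Fin n × Fin n))) :
    IsPrimcPartition n (l.map (toColouredPart n)).reverse ↔
      IsLadder (primcDiff n) (fun _ => 1) l := by
  have hchain : (l.map (toColouredPart n)).reverse.IsChain (fun x y => y.size ≤ x.size ∧
      minDiff x.aIdx x.bIdx y.aIdx y.bIdx ≤ (x.size : ℤ) - (y.size : ℤ)) ↔
      l.IsChain fun x y => primcDiff n y.2 x.2 + x.1 ≤ y.1 := by
    rw [List.isChain_reverse, List.isChain_map]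
    refine iff_of_eq (congrArg (fun R => List.IsChain R l) (funext fun x => funext fun y => ?_))
    simp only [toColouredPart, primcDiff, eq_iff_iff]
    omega
  rw [IsPrimcPartition, hchain]
  constructor
  · rintro ⟨h1, h2⟩
    refine isLadder_iff.2 ⟨fun x hx => ?_, h2⟩
    exact (h1 (toColouredPart n x)
      (List.mem_reverse.2 (List.mem_map_of_mem (List.mem_of_mem_head? hx)))).1
  · intro h
    refine ⟨fun x hx => ?_, (isLadder_iff.1 h).2⟩
    obtain ⟨y, hy, rfl⟩ := List.mem_map.1 (List.mem_reverse.1 hx)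
    exact ⟨pos_of_isLadder (fun _ => one_pos) h y hy, y.2.1.isLt, y.2.2.isLt⟩

/-- Generalised Primc partitions as ladders. -/
noncomputable def primcEquiv (n : ℕ) : (Σ t : ℕ, Ladder (primcDiff n) t fun _ => 1) ≃
    {l : List ColouredPart // IsPrimcPartition n l} :=
  Equiv.ofBijective (fun y => ⟨(y.2.1.map (toColouredPart n)).reverse,
    (isPrimcPartition_iff n _).2 y.2.2.2⟩) <| by
    constructor
    · rintro ⟨t, l, rfl, hl⟩ ⟨t', l', rfl, hl'⟩ h
      obtain rfl := (toColouredPart_injective n).list_map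
        (List.reverse_injective (Subtype.ext_iff.1 h))
      rfl
    · rintro ⟨L, hL⟩
      obtain ⟨l, rfl⟩ := eq_reverse_map_of_forall (toColouredPart n) L fun x hx =>
        ⟨(x.size, ⟨x.aIdx, (hL.1 x hx).2.1⟩, ⟨x.bIdx, (hL.1 x hx).2.2⟩), rfl⟩
      exact ⟨⟨l.length, l, rfl, (isPrimcPartition_iff n l).1 hL⟩, rfl⟩

/-- The monomial of a weight and of numbers of appearances of the symbols. -/
noncomputable def statWeight (n : ℕ) (x : ℕ × (Fin n → ℕ) × (Fin n → ℕ)) : QSeries :=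
  qPow x.1 * ∏ i : Fin n, aPow i ((x.2.1 i : ℤ) - (x.2.2 i : ℤ))

theorem statWeight_eq (n m : ℕ) (u v : Fin n → ℕ) :
    statWeight n (m, u, v) =
      qPow m * ((∏ i : Fin n, aPow i (1 * (u i : ℤ))) * ∏ i : Fin n, aPow i (-1 * (v i : ℤ))) := by
  rw [statWeight, ← Finset.prod_mul_distrib]
  congr 1
  refine Finset.prod_congr rfl fun i _ => ?_
  rw [← aPow_add]
  ring_nf

/-- The statistics of a generalised Primc partition. -/
def primcStat (n : ℕ) (l : List ColouredPart) : ℕ × (Fin n → ℕ) × (Fin n → ℕ) :=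
  ((l.map ColouredPart.size).sum, fun i => l.countP fun x => x.aIdx = (i : ℕ),
    fun i => l.countP fun x => x.bIdx = (i : ℕ))

theorem statWeight_primcStat (n : ℕ) (l : List (ℕ × (Fin n × Fin n))) :
    statWeight n (primcStat n (l.map (toColouredPart n)).reverse) =
      ladderWeight (primcWeight n) l := by
  have h1 : ∀ x ∈ (l.map (toColouredPart n)).reverse, x.aIdx < n ∧ x.bIdx < n := fun x hx => by
    obtain ⟨y, -, rfl⟩ := List.mem_map.1 (List.mem_reverse.1 hx)
    exact ⟨y.2.1.isLt, y.2.2.isLt⟩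
  rw [primcStat, statWeight_eq, ← prod_map_aPow ColouredPart.aIdx 1 _ fun x hx => (h1 x hx).1,
    ← prod_map_aPow ColouredPart.bIdx (-1) _ fun x hx => (h1 x hx).2, ← prod_map_qPow,
    ← List.prod_map_mul, ← List.prod_map_mul, List.map_reverse, List.prod_reverse, List.map_map,
    ladderWeight]
  congr 1
  refine List.map_congr_left fun x _ => ?_
  simp only [Function.comp_apply, toColouredPart, primcWeight]
  ring

theorem countTerm_primcCount (n : ℕ) (x : ℕ × (Fin n → ℕ) × (Fin n → ℕ)) :
    countTerm n (primcCount n) x =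
      ({l : {l : List ColouredPart // IsPrimcPartition n l} | primcStat n l.1 = x}.ncard : QSeries) *
        statWeight n x := by
  have : primcPartitions n x.1 x.2.1 x.2.2 =
      Subtype.val '' {l : {l : List ColouredPart // IsPrimcPartition n l} | primcStat n l.1 = x} := by
    ext l
    obtain ⟨m, u, v⟩ := x
    simp [primcPartitions, primcStat, funext_iff]
    exact and_comm
  rw [countTerm, primcCount, this, Set.ncard_image_of_injective _ Subtype.val_injective, mul_assoc]
  rfl

theorem summable_primc (n : ℕ) : Summable fun y : Σ t : ℕ, Ladder (primcDiff n) t fun _ => 1 =>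
    ladderWeight (primcWeight n) y.2.1 := by
  refine summable_of_ordGE (fun y => ((y.2.1.map Prod.fst).sum : ℕ))
    (fun y => ordGE_ladderWeight (ordGE_primcWeight n) y.2.1) fun N => ?_
  have hs : {x : ℕ × (Fin n × Fin n) | x.1 < N.toNat}.Finite :=
    ((Set.finite_Iio N.toNat).prod Set.finite_univ).subset fun x hx => ⟨hx, trivial⟩
  refine Set.Finite.of_finite_image (f := fun y => y.2.1)
    ((finite_lists_of_bound _ hs N.toNat).subset ?_) ?_
  · rintro _ ⟨y, hy, rfl⟩
    have h1 := length_le_sum_map Prod.fst y.2.1 (pos_of_isLadder (fun _ => one_pos) y.2.2.2)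
    simp only [Set.mem_ofPred_eq] at hy ⊢
    refine ⟨by omega, fun x hx => ?_⟩
    have h2 := le_sum_map Prod.fst y.2.1 x hx
    omega
  · rintro ⟨t, l, rfl, hl⟩ - ⟨t', l', rfl, hl'⟩ - h
    obtain rfl : l = l' := h
    rfl

/-- The partial sums over the number of parts are `hPlus` at `(0, 0)`, in which `(q)_t / (q)_{t-v}`
tends to 1. -/
theorem tsum_primc (N : ℕ) :
    ∑' y : Σ t : ℕ, Ladder (primcDiff (N + 1)) t fun _ => 1,
      ladderWeight (primcWeight (N + 1)) y.2.1 = ∑' t, rowA (N + 1) 0 t * rowB (N + 1) 0 t := by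
  have h1 : HasSum (fun t => ladderSum (primcDiff (N + 1)) (primcWeight (N + 1)) t fun _ => 1)
      (∑' y : Σ t : ℕ, Ladder (primcDiff (N + 1)) t fun _ => 1,
        ladderWeight (primcWeight (N + 1)) y.2.1) :=
    HasSum.sigma (summable_primc (N + 1)).hasSum fun t =>
      (summable_ladder (ordGE_primcWeight (N + 1)) t _).hasSum
  have h2 := ((tendsto_add_atTop_iff_nat 1).2 h1.tendsto_sum_nat).congr (ladderSum_primc_one N)
  refine tendsto_nhds_unique h2 (tendsto_sum_qFall_mul one_pos fun v => ?_)
  -- The factor `q^v` of `rowA` supplies the order `v` that the limit requires.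
  rw [rowA_zero_eq]
  exact (((ordGE_qPow v).mul (ordGE_ladderSum (ordGE_aWeight _) _ _)).mul
    (ordGE_ladderSum (ordGE_bWeight _) _ _)).mono (by simp)

theorem hasSum_primcCount (N : ℕ) :
    HasSum (countTerm (N + 1) (primcCount (N + 1)))
      (∑' t, rowA (N + 1) 0 t * rowB (N + 1) 0 t) := by
  have h1 : HasSum (fun l : {l : List ColouredPart // IsPrimcPartition (N + 1) l} =>
      statWeight (N + 1) (primcStat (N + 1) l.1)) (∑' t, rowA (N + 1) 0 t * rowB (N + 1) 0 t) := by
    refine (primcEquiv (N + 1)).hasSum_iff.1 ?_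
    rw [← tsum_primc]
    exact (summable_primc (N + 1)).hasSum.of_eq (fun y => statWeight_primcStat (N + 1) y.2.1) rfl
  refine (hasSum_ncard_fibre (fun l : {l : List ColouredPart // IsPrimcPartition (N + 1) l} =>
    primcStat (N + 1) l.1) (statWeight (N + 1)) h1.summable fun x => ?_).of_eq
      (countTerm_primcCount (N + 1)) h1.tsum_eq.symm
  refine Set.Finite.of_finite_image ((primcPartitions_finite (N + 1) x.1 x.2.1 x.2.2).subset ?_)
    Subtype.val_injective.injOn
  rintro _ ⟨l, rfl, rfl⟩
  exact ⟨l.2, rfl, fun _ => rfl, fun _ => rfl⟩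

/-! #### Frobenius partitions -/

/-- A part, with its colour given by an index less than `n`. -/
def toPrimaryPart (n : ℕ) (x : ℕ × Fin n) : PrimaryPart := ⟨x.1, x.2⟩

theorem toPrimaryPart_injective (n : ℕ) : Function.Injective (toPrimaryPart n) := by
  rintro ⟨a, b⟩ ⟨a', b'⟩ h
  simp only [toPrimaryPart, PrimaryPart.mk.injEq] at h
  ext
  · exact h.1
  · exact h.2

theorem isChain_aLT_iff (n : ℕ) (l : List (ℕ × Fin n)) :
    (l.map (toPrimaryPart n)).reverse.IsChain (fun x y => aLT y x) ↔
      IsLadder (aDiff n) (fun _ => 0) l := by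
  rw [isLadder_iff, List.isChain_reverse, List.isChain_map]
  simp only [zero_le, implies_true, true_and]
  refine iff_of_eq (congrArg (fun R => List.IsChain R l) (funext fun x => funext fun y => ?_))
  simp only [toPrimaryPart, aDiff, aLT, eq_iff_iff, Fin.le_def]
  split_ifs <;> omega

theorem isChain_bLT_iff (n : ℕ) (l : List (ℕ × Fin n)) :
    (l.map (toPrimaryPart n)).reverse.IsChain (fun x y => bLT y x) ↔
      IsLadder (bDiff n) (fun _ => 0) l := by
  rw [isLadder_iff, List.isChain_reverse, List.isChain_map]
  simp only [zero_le, implies_true, true_and]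
  refine iff_of_eq (congrArg (fun R => List.IsChain R l) (funext fun x => funext fun y => ?_))
  simp only [toPrimaryPart, bDiff, bLT, eq_iff_iff, Fin.le_def]
  split_ifs <;> omega

/-- Frobenius partitions as pairs of ladders of the same length. -/
noncomputable def frobeniusEquiv (n : ℕ) :
    (Σ t : ℕ, Ladder (aDiff n) t (fun _ => 0) × Ladder (bDiff n) t (fun _ => 0)) ≃
      {π : List PrimaryPart × List PrimaryPart // IsFrobeniusPartition n π} :=
  Equiv.ofBijective (fun y => ⟨((y.2.1.1.map (toPrimaryPart n)).reverse,
    (y.2.2.1.map (toPrimaryPart n)).reverse),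
    { length_eq := by simp [y.2.1.2.1, y.2.2.2.1]
      idx_lt₁ := fun x hx => by
        obtain ⟨z, -, rfl⟩ := List.mem_map.1 (List.mem_reverse.1 hx)
        exact z.2.isLt
      idx_lt₂ := fun x hx => by
        obtain ⟨z, -, rfl⟩ := List.mem_map.1 (List.mem_reverse.1 hx)
        exact z.2.isLt
      decreasing₁ := (isChain_aLT_iff n _).2 y.2.1.2.2
      decreasing₂ := (isChain_bLT_iff n _).2 y.2.2.2.2 }⟩) <| by
    constructor
    · rintro ⟨t, ⟨l, rfl, hl⟩, k, hk1, hk⟩ ⟨t', ⟨l', rfl, hl'⟩, k', hk1', hk'⟩ h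
      have h1 := Prod.ext_iff.1 (Subtype.ext_iff.1 h)
      obtain rfl := (toPrimaryPart_injective n).list_map (List.reverse_injective h1.1)
      obtain rfl := (toPrimaryPart_injective n).list_map (List.reverse_injective h1.2)
      rfl
    · rintro ⟨⟨L, M⟩, h⟩
      obtain ⟨l, rfl⟩ := eq_reverse_map_of_forall (toPrimaryPart n) L fun x hx =>
        ⟨(x.size, ⟨x.idx, h.idx_lt₁ x hx⟩), rfl⟩
      obtain ⟨k, rfl⟩ := eq_reverse_map_of_forall (toPrimaryPart n) M fun x hx =>
        ⟨(x.size, ⟨x.idx, h.idx_lt₂ x hx⟩), rfl⟩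
      refine ⟨⟨l.length, ⟨l, rfl, (isChain_aLT_iff n l).1 h.decreasing₁⟩,
        ⟨k, ?_, (isChain_bLT_iff n k).1 h.decreasing₂⟩⟩, rfl⟩
      simpa using h.length_eq.symm

/-- The statistics of a Frobenius partition. -/
def frobeniusStat (n : ℕ) (π : List PrimaryPart × List PrimaryPart) :
    ℕ × (Fin n → ℕ) × (Fin n → ℕ) :=
  (π.1.length + (π.1.map PrimaryPart.size).sum + (π.2.map PrimaryPart.size).sum,
    fun i => π.1.countP fun x => x.idx = (i : ℕ), fun i => π.2.countP fun x => x.idx = (i : ℕ))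

theorem statWeight_frobeniusStat (n : ℕ) (l k : List (ℕ × Fin n)) :
    statWeight n (frobeniusStat n ((l.map (toPrimaryPart n)).reverse,
      (k.map (toPrimaryPart n)).reverse)) =
      qPow l.length * ladderWeight (aWeight n) l * ladderWeight (bWeight n) k := by
  have h1 : ∀ l : List (ℕ × Fin n), ∀ x ∈ (l.map (toPrimaryPart n)).reverse, x.idx < n :=
    fun l x hx => by
      obtain ⟨y, -, rfl⟩ := List.mem_map.1 (List.mem_reverse.1 hx)
      exact y.2.isLt
  have h2 : ∀ (l : List (ℕ × Fin n)) (k : ℤ), ladderWeight (fun i : Fin n => aPow i k) l =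
      (((l.map (toPrimaryPart n)).reverse).map fun x => aPow x.idx k).prod *
        (((l.map (toPrimaryPart n)).reverse).map fun x => qPow x.size).prod := fun l k => by
    rw [← List.prod_map_mul, List.map_reverse, List.prod_reverse, List.map_map]
    rfl
  rw [frobeniusStat, statWeight_eq, ← prod_map_aPow PrimaryPart.idx 1 _ (h1 l),
    ← prod_map_aPow PrimaryPart.idx (-1) _ (h1 k)]
  have h3 : ladderWeight (aWeight n) l = _ := h2 l 1
  have h4 : ladderWeight (bWeight n) k = _ := h2 k (-1)
  rw [h3, h4, prod_map_qPow, prod_map_qPow]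
  simp only [List.length_reverse, List.length_map]
  push_cast
  rw [qPow_add, qPow_add]
  ring

theorem countTerm_frobeniusCount (n : ℕ) (x : ℕ × (Fin n → ℕ) × (Fin n → ℕ)) :
    countTerm n (frobeniusCount n) x =
      ({π : {π : List PrimaryPart × List PrimaryPart // IsFrobeniusPartition n π} |
        frobeniusStat n π.1 = x}.ncard : QSeries) * statWeight n x := by
  have : frobeniusPartitions n x.1 x.2.1 x.2.2 =
      Subtype.val '' {π : {π : List PrimaryPart × List PrimaryPart // IsFrobeniusPartition n π} |
        frobeniusStat n π.1 = x} := by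
    ext π
    obtain ⟨m, u, v⟩ := x
    simp [frobeniusPartitions, frobeniusStat, funext_iff]
    exact and_comm
  rw [countTerm, frobeniusCount, this, Set.ncard_image_of_injective _ Subtype.val_injective,
    mul_assoc]
  rfl

theorem summable_frobenius (n : ℕ) :
    Summable fun y : Σ t : ℕ, Ladder (aDiff n) t (fun _ => 0) × Ladder (bDiff n) t (fun _ => 0) =>
      qPow y.2.1.1.length * ladderWeight (aWeight n) y.2.1.1 *
        ladderWeight (bWeight n) y.2.2.1 := by
  refine summable_of_ordGE (fun y => ((y.2.1.1.length : ℤ) + ((y.2.1.1.map Prod.fst).sum : ℕ) +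
    ((y.2.2.1.map Prod.fst).sum : ℕ))) (fun y => ((ordGE_qPow _).mul
      (ordGE_ladderWeight (ordGE_aWeight n) y.2.1.1)).mul
        (ordGE_ladderWeight (ordGE_bWeight n) y.2.2.1)) fun N => ?_
  have hs : {x : ℕ × Fin n | x.1 < N.toNat}.Finite :=
    ((Set.finite_Iio N.toNat).prod Set.finite_univ).subset fun x hx => ⟨hx, trivial⟩
  refine Set.Finite.of_finite_image (f := fun y => (y.2.1.1, y.2.2.1))
    (((finite_lists_of_bound _ hs N.toNat).prod (finite_lists_of_bound _ hs N.toNat)).subset ?_) ?_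
  · rintro _ ⟨y, hy, rfl⟩
    have h1 := y.2.1.2.1
    have h2 := y.2.2.2.1
    simp only [Set.mem_ofPred_eq] at hy
    refine ⟨⟨?_, fun x hx => ?_⟩, ?_, fun x hx => ?_⟩
    · simp only
      omega
    · have h3 := le_sum_map Prod.fst y.2.1.1 x hx
      simp only [Set.mem_ofPred_eq]
      omega
    · simp only
      omega
    · have h3 := le_sum_map Prod.fst y.2.2.1 x hx
      simp only [Set.mem_ofPred_eq]
      omega
  · rintro ⟨t, ⟨l, rfl, hl⟩, k, hk1, hk⟩ - ⟨t', ⟨l', rfl, hl'⟩, k', hk1', hk'⟩ - h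
    obtain ⟨rfl, rfl⟩ : l = l' ∧ k = k' := Prod.ext_iff.1 h
    rfl

theorem tsum_frobenius (n : ℕ) :
    ∑' y : Σ t : ℕ, Ladder (aDiff n) t (fun _ => 0) × Ladder (bDiff n) t (fun _ => 0),
      qPow y.2.1.1.length * ladderWeight (aWeight n) y.2.1.1 * ladderWeight (bWeight n) y.2.2.1 =
    ∑' t, rowA n 0 t * rowB n 0 t := by
  have h1 : HasSum (fun t => rowA n 0 t * rowB n 0 t) _ :=
    HasSum.sigma (summable_frobenius n).hasSum fun t => by
      have h2 := (hasSum_mul_prod (summable_ladder (D := aDiff n) (ordGE_aWeight n) t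
        fun _ => 0).hasSum (summable_ladder (D := bDiff n) (ordGE_bWeight n) t
          fun _ => 0).hasSum).mul_left (qPow t)
      refine h2.of_eq (fun y => ?_) ?_
      · simp only
        rw [y.1.2.1, mul_assoc]
      -- The `q^t` from the `t` columns makes all parts of the first row positive, which gives `rowA
      -- n 0 t`.
      · rw [rowA_zero_eq, rowB_zero_eq, mul_assoc]
        rfl
  exact h1.tsum_eq.symm

theorem hasSum_frobeniusCount (n : ℕ) :
    HasSum (countTerm n (frobeniusCount n)) (∑' t, rowA n 0 t * rowB n 0 t) := by
  have h1 : HasSum (fun π : {π : List PrimaryPart × List PrimaryPart // IsFrobeniusPartition n π} =>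
      statWeight n (frobeniusStat n π.1)) (∑' t, rowA n 0 t * rowB n 0 t) := by
    refine (frobeniusEquiv n).hasSum_iff.1 ?_
    rw [← tsum_frobenius]
    exact (summable_frobenius n).hasSum.of_eq
      (fun y => statWeight_frobeniusStat n y.2.1.1 y.2.2.1) rfl
  refine (hasSum_ncard_fibre (fun π : {π : List PrimaryPart × List PrimaryPart //
    IsFrobeniusPartition n π} => frobeniusStat n π.1) (statWeight n) h1.summable fun x => ?_).of_eq
      (countTerm_frobeniusCount n) h1.tsum_eq.symm
  refine Set.Finite.of_finite_image ((frobeniusPartitions_finite n x.1 x.2.1 x.2.2).subset ?_)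
    Subtype.val_injective.injOn
  rintro _ ⟨π, rfl, rfl⟩
  exact ⟨π.2, rfl, fun _ => rfl, fun _ => rfl⟩

/-- One of the `N + 1` factors `y` stays in front and each `i` from 1 to `N` receives one. -/
theorem inverse_pow_mul_prod_mul (N : ℕ) (y X : QSeries) (f : ℕ → QSeries) :
    y ^ (N + 1) * ((∏ i ∈ Finset.Ico 1 (N + 1), f i) * X) =
      y * (∏ i ∈ Finset.Ico 1 (N + 1), f i * y) * X := by
  rw [Finset.prod_mul_distrib, Finset.prod_const, Nat.card_Ico, Nat.add_sub_cancel, pow_succ]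
  ring

end PrimcFrobenius

theorem mainTheorem5 (n : ℕ) (hn : 0 < n) :
    Summable (countTerm n (primcCount n)) ∧
    Summable (countTerm n (frobeniusCount n)) ∧
    Summable (latticeTerm n) ∧
    ∑' x, countTerm n (primcCount n) x = ∑' x, countTerm n (frobeniusCount n) x ∧
    ∑' x, countTerm n (frobeniusCount n) x =
      Ring.inverse (qPochhammer (qPow 1) 1) ^ n * ∑' s : Fin (n - 1) → ℤ, latticeTerm n s ∧
    Ring.inverse (qPochhammer (qPow 1) 1) ^ n * ∑' s : Fin (n - 1) → ℤ, latticeTerm n s =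
      Ring.inverse (qPochhammer (qPow 1) 1) *
        (∏ i ∈ Finset.Ico 1 n,
          (qPochhammer (qPow ((i : ℤ) * (i + 1))) (i * (i + 1)) *
            Ring.inverse (qPochhammer (qPow 1) 1))) *
        ∑ r : (j : Fin (n - 1)) → Fin (j.val + 1),
          residueTerm n (fun j => ((r j : ℕ) : ℤ)) := by
  obtain ⟨N, rfl⟩ := Nat.exists_eq_add_of_le' hn
  have hP := hasSum_primcCount N
  have hF := hasSum_frobeniusCount (N + 1)
  have hL := hasSum_latticeTerm N
  refine ⟨hP.summable, hF.summable, hL.summable, hP.tsum_eq.trans hF.tsum_eq.symm,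
    hF.tsum_eq.trans (rowSystem (N + 1)).tsum_rows, ?_⟩
  rw [hL.tsum_eq]
  exact inverse_pow_mul_prod_mul N _ _ _
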